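/- Let $s\in\mathbb N$, $m\ge 2$, and let $f_1,\dots,f_m\in\mathbb Z[x_1,\dots,x_s]$ be non-zero polynomials that have no common factor of positive degree in $\mathbb Z[x_1,\dots,x_s]$. For $n=1,2,\dots$ let $\mathbf U_n$ be a random vector with the uniform distribution on $\{1,\dots,n\}^s$. For integers $a_1,\dots,a_m$ let $\mathrm{GCD}(a_1,\dots,a_m)$ be the greatest common divisor of $|a_1|,\dots,|a_m|$, where zeros among the $a_i$ are ignored (and the value is $0$ if all $a_i$ are zero). Let $\mathcal P$ be the set of primes, and let $\widehat{\mathbb Z}=\prod_{p\in\mathcal P}\mathbb Z_p$ be the compact ring of integer adeles, with its Haar probability measure $\widehat\mu=\prod_{p\in\mathcal P}\mu_p$, where $\mu_p$ is the Haar probability measure on $\mathbb Z_p$. For $x=\bigl(\sum_{k\ge0}a_{k,p}p^k\bigr)_{p\in\mathcal P}\in\widehat{\mathbb Z}$ with digits $a_{k,p}\in\{0,\dots,p-1\}$ put $\lambda_p(x)=\inf\{k\ge 0: a_{k,p}>0\}\in\{0,1,2,\dots\}\cup\{+\infty\}$, with $\inf\varnothing=+\infty$. Let $\mathcal V_1,\dots,\mathcal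 V_s$ be independent random elements of $\widehat{\mathbb Z}$ with distribution $\widehat\mu$, defined on a common probability space. Then there is a random variable $G$ on that probability space, with values in $\{1,2,3,\dots\}$, such that $$\mathrm{GCD}\bigl(f_1(\mathbf U_n),\dots,f_m(\mathbf U_n)\bigr)\ \overset{\mathrm d}{\longrightarrow}\ G,\qquad n\to\infty,$$ and such that, almost surely, $\min_{i=1,\dots,m}\lambda_p(f_i(\mathcal V_1,\dots,\mathcal V_s))<\infty$ for all $p\in\mathcal P$, and $$\log G=\sum_{p\in\mathcal P}\log p\,\min_{i=1,\dots,m}\lambda_p\bigl(f_i(\mathcal V_1,\dots,\mathcal V_s)\bigr),$$ where the series converges. -/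

import Mathlib

open MeasureTheory ProbabilityTheory Filter
open scoped Topology

instance factPrimeOfPrimes (p : Nat.Primes) : Fact (p : ℕ).Prime := ⟨p.2⟩

/-- `ℤ_[p]` carries its Borel σ-algebra. -/
noncomputable instance padicIntMeasurableSpace (p : ℕ) [Fact p.Prime] : MeasurableSpace ℤ_[p] := borel _

instance padicIntBorelSpace (p : ℕ) [Fact p.Prime] : BorelSpace ℤ_[p] := ⟨rfl⟩

/-- The topological ring of integer adeles: the product over all primes `p` of the rings `ℤ_[p]`,
with the coordinatewise operations, the product topology and the product σ-algebra. -/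
abbrev IntegerAdele : Type := ∀ p : Nat.Primes, ℤ_[(p : ℕ)]

namespace IntegerAdele

/-- The Haar probability measure on `ℤ_[p]`: the translation invariant Borel measure giving
mass one to the whole compact group. -/
noncomputable def padicHaar (p : ℕ) [Fact p.Prime] : Measure ℤ_[p] :=
  Measure.addHaarMeasure ⊤

instance padicHaar_isProbabilityMeasure (p : ℕ) [Fact p.Prime] :
    IsProbabilityMeasure (padicHaar p) :=
  ⟨Measure.addHaarMeasure_self⟩

/-- The Haar probability measure on the integer adeles: the product over all primes `p` of the
Haar probability measures on `ℤ_[p]`. -/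
noncomputable def haar : Measure IntegerAdele :=
  Measure.infinitePi fun p : Nat.Primes => padicHaar p

/-- The `k`-th digit `a k ∈ {0, …, p - 1}` of the `p`-component `∑ k, a k * p ^ k` of an integer
adele. Here `PadicInt.appr y n` is the representative in `{0, …, p ^ n - 1}` of `y` modulo `p ^ n`,
that is, `∑ k < n, a k * p ^ k`. -/
noncomputable def digit (p : Nat.Primes) (k : ℕ) (x : IntegerAdele) : ℕ :=
  (x p).appr (k + 1) / (p : ℕ) ^ k

/-- The `p`-adic valuation `inf {k ≥ 0 : digit p k x > 0}` of an integer adele, with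
`inf ∅ = ∞`. -/
noncomputable def lambda (p : Nat.Primes) (x : IntegerAdele) : ℕ∞ :=
  sInf {k : ℕ∞ | ∃ j : ℕ, k = j ∧ 0 < digit p j x}

end IntegerAdele

/-- The greatest common divisor of `|a 1|, …, |a m|`. Zeros among the `a i` do not contribute, as
`gcd 0 b = b`; the value is `0` if all the `a i` vanish. -/
def absGCD {m : ℕ} (a : Fin m → ℤ) : ℕ :=
  Finset.univ.gcd fun i => (a i).natAbs

/-!
For a fixed modulus `q`, the number `gcd(GCD(f(x)), q)` depends only on the residues modulo `q` of
the point `x`. The residues of a uniform point of `{1, …, n} ^ s` converge in law to the uniform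
distribution on residue vectors, which is also the law of the residues of independent Haar
distributed integer adeles, since the residue classes in the integer adeles are translates of one
another (`IntegerAdele.tendsto_countIn_residue`). If `G` is the positive integer whose exponent at
each prime `p` is the minimal valuation of the values `f i` at the random integer adeles, it
follows that `gcd(GCD(f(U n)), q)` converges in law to `gcd(G, q)` for every `q`.

Passing from this to the convergence of the greatest common divisors themselves requires that a
large prime rarely divides all the values `f i (U n)`, uniformly in `n`
(`tendstoInDistribution_of_gcd`). This is a sieve estimate in the manner of Ekedahl and Poonen,
proved by induction on the number of variables: as the `f i` have no common factor of positive
degree, elimination of the first variable gives a nonzero polynomial `D` in the others that lies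
in the ideal of the `f i` (`exists_C_mem_span`, by Gauss's lemma), while the family of all
coefficients with respect to the first variable has again no common factor of positive degree. A
prime `p` dividing all values at a point divides `D` there; either it also divides all the
coefficients, which the induction hypothesis controls, or the first coordinate is confined to
boundedly many residue classes modulo `p`. For `p ≤ n` this gives a proportion `O(1 / p ^ 2)` of
points of the box (`NoCommonFactor.exists_card_dvd_le`). The primes `p > n` are treated all
together: where `D` does not vanish, its value has polynomial size in `n` and hence boundedly many
prime factors above `n` (`NoCommonFactor.exists_card_large_prime_le`).

The variable `G` exists for two reasons. In the limit `n → ∞` the bound `O(1 / p ^ 2)` holds for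
the integer adeles, so by the Borel–Cantelli lemma almost surely only finitely many primes have a
positive exponent. Each exponent is almost surely finite because the zero set of a nonzero
polynomial over the `p`-adic integers is a null set (`MvPolynomial.pi_setOf_eval_eq_zero`).
-/

/-! ### Elimination of a variable -/

open nonZeroDivisors in
attribute [local instance] Polynomial.algebra Polynomial.isLocalization in
/-- A family of polynomials over a factorial ring `R` without a common factor of positive
degree in `X` generates an ideal that contains a nonzero constant: over the fraction field the
ideal is generated by a common divisor, which by Gauss's lemma is constant. -/
theorem exists_C_mem_span {R : Type*} [CommRing R] [IsDomain R] [UniqueFactorizationMonoid R]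
    (F : Set (Polynomial R)) (hne : ∃ f ∈ F, f ≠ 0)
    (hF : ∀ g : Polynomial R, (∀ f ∈ F, g ∣ f) → g.natDegree = 0) :
    ∃ D : R, D ≠ 0 ∧ Polynomial.C D ∈ Ideal.span F := by
  classical
  let _ : StrongNormalizationMonoid R := UniqueFactorizationMonoid.strongNormalizationMonoid
  let _ : NormalizedGCDMonoid R := UniqueFactorizationMonoid.toNormalizedGCDMonoid R
  let K := FractionRing R
  have halg : ∀ f : Polynomial R,
      algebraMap (Polynomial R) (Polynomial K) f = f.map (algebraMap R K) := fun f => rfl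
  set I : Ideal (Polynomial K) := (Ideal.span F).map (algebraMap (Polynomial R) (Polynomial K))
    with hI
  obtain ⟨h, hh⟩ := (inferInstance : I.IsPrincipal)
  have hdvd : ∀ f ∈ F, h ∣ f.map (algebraMap R K) := fun f hf => by
    have : f.map (algebraMap R K) ∈ I := Ideal.mem_map_of_mem _ (Ideal.subset_span hf)
    rw [hh] at this
    exact Ideal.mem_span_singleton.1 this
  have hinj : Function.Injective (Polynomial.map (algebraMap R K)) :=
    Polynomial.map_injective _ (IsFractionRing.injective R K)
  have h0 : h ≠ 0 := by
    rintro rfl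
    obtain ⟨f, hf, hf0⟩ := hne
    have := zero_dvd_iff.1 (hdvd f hf)
    exact hf0 (hinj (by simpa using this))
  set r := (IsLocalization.integerNormalization R⁰ h) with hr
  have hr0 : r ≠ 0 := by
    rw [hr, Ne, IsFractionRing.integerNormalization_eq_zero_iff]; exact h0
  obtain ⟨b, hb, hb'⟩ := IsLocalization.integerNormalization_spec R⁰ h
  have hb0 : algebraMap R K b ≠ 0 := by
    simpa using nonZeroDivisors.ne_zero hb
  have hprdvd : r.primPart.map (algebraMap R K) ∣ h := by
    have h1 : r.map (algebraMap R K) = Polynomial.C (algebraMap R K b) * h := by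
      rw [hb', ← Polynomial.smul_eq_C_mul, algebraMap_smul]
    have h2 : r.primPart.map (algebraMap R K) ∣ Polynomial.C (algebraMap R K b) * h := by
      rw [← h1]; exact Polynomial.map_dvd _ (Polynomial.primPart_dvd r)
    have hu : IsUnit (Polynomial.C (algebraMap R K b)) := Polynomial.isUnit_C.2 hb0.isUnit
    exact (hu.dvd_mul_left).1 h2
  -- Gauss's lemma: the primitive part of `r` divides each `f` already over `R`.
  have hdeg : r.primPart.natDegree = 0 := hF _ fun f hf =>
    r.isPrimitive_primPart.dvd_of_fraction_map_dvd_fraction_map (K := K)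
      (hprdvd.trans (hdvd f hf))
  have hunit : IsUnit h := by
    have h1 : r.natDegree = 0 := by rw [← Polynomial.natDegree_primPart]; exact hdeg
    have h2 : (r.map (algebraMap R K)).natDegree = 0 := by
      rw [Polynomial.natDegree_map_eq_of_injective (IsFractionRing.injective R K), h1]
    rw [hb', ← algebraMap_smul K b h, Polynomial.natDegree_smul _ hb0] at h2
    exact Polynomial.isUnit_iff_degree_eq_zero.2
      ((Polynomial.degree_eq_iff_natDegree_eq h0).2 h2)
  have htop : I = ⊤ := by
    rw [hh]; exact Ideal.span_singleton_eq_top.2 hunit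
  -- `K[X]` is the localization of `R[X]` at the nonzero constants.
  have := mt (IsLocalization.map_algebraMap_ne_top_iff_disjoint
    (Submonoid.map (Polynomial.C : R →+* Polynomial R) R⁰) (Polynomial K) (Ideal.span F)).2
    (by rw [← hI]; simpa using htop)
  obtain ⟨x, hx, hx'⟩ := Set.not_disjoint_iff.1 this
  obtain ⟨D, hD, rfl⟩ := hx
  exact ⟨D, nonZeroDivisors.ne_zero hD, hx'⟩

/-! ### Counting integer points of a box -/

open Classical in
/-- The number of elements of `S` with the property `Q`. -/
noncomputable def countIn {α : Type*} (S : Finset α) (Q : α → Prop) : ℕ := (S.filter Q).card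

lemma countIn_eq {α : Type*} (S : Finset α) (Q : α → Prop) [DecidablePred Q] :
    countIn S Q = (S.filter Q).card := by
  rw [countIn]; congr

lemma countIn_le_card {α : Type*} (S : Finset α) (Q : α → Prop) : countIn S Q ≤ S.card := by
  classical
  rw [countIn_eq]; exact Finset.card_filter_le _ _

lemma countIn_mono {α : Type*} {S : Finset α} {Q R : α → Prop} (h : ∀ x ∈ S, Q x → R x) :
    countIn S Q ≤ countIn S R := by
  classical
  rw [countIn_eq, countIn_eq]
  refine Finset.card_le_card fun x hx => ?_
  rw [Finset.mem_filter] at hx ⊢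
  exact ⟨hx.1, h x hx.1 hx.2⟩

lemma countIn_eq_zero {α : Type*} {S : Finset α} {Q : α → Prop} (h : ∀ x ∈ S, ¬ Q x) :
    countIn S Q = 0 := by
  classical
  rw [countIn_eq, Finset.filter_eq_empty_iff.2 h, Finset.card_empty]

lemma countIn_true {α : Type*} (S : Finset α) : countIn S (fun _ => True) = S.card := by
  classical
  rw [countIn_eq, Finset.filter_true]

lemma countIn_or_le {α : Type*} (S : Finset α) (Q R : α → Prop) :
    countIn S (fun x => Q x ∨ R x) ≤ countIn S Q + countIn S R := by
  classical
  rw [countIn_eq, countIn_eq, countIn_eq, Finset.filter_or]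
  exact Finset.card_union_le _ _

lemma countIn_exists_le {α β : Type*} (S : Finset α) (T : Finset β) (Q : β → α → Prop) :
    countIn S (fun x => ∃ b ∈ T, Q b x) ≤ ∑ b ∈ T, countIn S (Q b) := by
  classical
  have h : S.filter (fun x => ∃ b ∈ T, Q b x) = T.biUnion fun b => S.filter (Q b) := by
    ext x; simp; tauto
  simp only [countIn_eq]
  rw [h]
  exact Finset.card_biUnion_le

/-- The integer points of the box `{1, …, n} ^ s`. -/
noncomputable def box (s n : ℕ) : Finset (Fin s → ℤ) :=
  Fintype.piFinset fun _ => Finset.Icc 1 (n : ℤ)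

lemma mem_box {s n : ℕ} {x : Fin s → ℤ} : x ∈ box s n ↔ ∀ j, 1 ≤ x j ∧ x j ≤ (n : ℤ) := by
  simp [box]

lemma card_box (s n : ℕ) : (box s n).card = n ^ s := by
  simp [box, Fintype.card_piFinset]

lemma cons_mem_box {s n : ℕ} {t : ℤ} {x : Fin s → ℤ} :
    (Fin.cons t x : Fin (s + 1) → ℤ) ∈ box (s + 1) n ↔ t ∈ Finset.Icc 1 (n : ℤ) ∧ x ∈ box s n := by
  simp [mem_box, Fin.forall_fin_succ]

lemma countIn_box_succ {s n : ℕ} (Q : (Fin (s + 1) → ℤ) → Prop) :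
    countIn (box (s + 1) n) Q =
      ∑ x ∈ box s n, countIn (Finset.Icc 1 (n : ℤ)) fun t => Q (Fin.cons t x) := by
  classical
  simp only [countIn_eq]
  rw [← Finset.card_sigma]
  refine Finset.card_bij' (fun x _ => ⟨Fin.tail x, x 0⟩) (fun y _ => Fin.cons y.2 y.1) ?_ ?_ ?_ ?_
  · intro x hx
    rw [Finset.mem_filter] at hx
    obtain ⟨h1, h2⟩ := hx
    rw [← Fin.cons_self_tail x, cons_mem_box] at h1
    simp only [Finset.mem_sigma, Finset.mem_filter, Fin.cons_self_tail]
    exact ⟨h1.2, h1.1, h2⟩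
  · rintro ⟨x, t⟩ hy
    simp only [Finset.mem_sigma, Finset.mem_filter] at hy
    rw [Finset.mem_filter, cons_mem_box]
    exact ⟨⟨hy.2.1, hy.1⟩, hy.2.2⟩
  · intro x _
    simp
  · rintro ⟨x, t⟩ _
    simp

/-- Fibrewise count in a box: the points over `A` contribute full fibres, the remaining ones lie
over `B`, in fibres of at most `k` points. -/
lemma countIn_box_succ_le {s n : ℕ} (Q : (Fin (s + 1) → ℤ) → Prop) (A B : (Fin s → ℤ) → Prop)
    {k : ℝ} (hk0 : 0 ≤ k) (h : ∀ x ∈ box s n, ∀ t ∈ Finset.Icc 1 (n : ℤ),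
      Q (Fin.cons t x) → A x ∨ B x)
    (hk : ∀ x ∈ box s n, ¬ A x →
      (countIn (Finset.Icc 1 (n : ℤ)) (fun t => Q (Fin.cons t x)) : ℝ) ≤ k) :
    (countIn (box (s + 1) n) Q : ℝ) ≤ n * countIn (box s n) A + k * countIn (box s n) B := by
  classical
  rw [countIn_box_succ, countIn_eq _ A, countIn_eq _ B, Finset.card_filter, Finset.card_filter]
  push_cast
  rw [Finset.mul_sum, Finset.mul_sum, ← Finset.sum_add_distrib]
  refine Finset.sum_le_sum fun x hx => ?_
  by_cases hA : A x
  · have h1 : (countIn (Finset.Icc 1 (n : ℤ)) (fun t => Q (Fin.cons t x)) : ℝ) ≤ n := by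
      have := countIn_le_card (Finset.Icc 1 (n : ℤ)) (fun t => Q (Fin.cons t x))
      rw [Int.card_Icc] at this
      have h2 : ((n : ℤ) + 1 - 1).toNat = n := by simp
      rw [h2] at this
      exact_mod_cast this
    by_cases hB : B x
    · simp only [hA, hB, if_true, mul_one]; linarith
    · simpa [hA, hB] using h1
  · by_cases hB : B x
    · simpa [hA, hB] using hk x hx hA
    · have : countIn (Finset.Icc 1 (n : ℤ)) (fun t => Q (Fin.cons t x)) = 0 :=
        countIn_eq_zero fun t ht hQ => (h x hx t ht hQ).elim hA hB
      simp [hA, hB, this]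

/-- A residue class modulo `q` has `n / q` elements in `{1, …, n}`, up to an error of at most
one. -/
lemma abs_card_modEq_sub_le (n : ℕ) {q : ℕ} (hq : 0 < q) (v : ℤ) :
    |(countIn (Finset.Icc 1 (n : ℤ)) (fun t => t ≡ v [ZMOD q]) : ℝ) - n / q| ≤ 1 := by
  rw [countIn_eq]
  have h1 : Finset.Icc 1 (n : ℤ) = Finset.Ioc 0 (n : ℤ) := by ext; simp; omega
  have hq' : (0 : ℤ) < q := by exact_mod_cast hq
  have h2 := Int.Ioc_filter_modEq_card 0 (n : ℤ) hq' v
  rw [h1]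
  have hqQ : (0 : ℚ) < q := by exact_mod_cast hq
  set a : ℚ := (n - v) / q with ha
  set b : ℚ := (0 - v) / q with hb
  have hab : a - b = n / q := by rw [ha, hb]; field_simp; ring
  have hba : b ≤ a := by
    have : (0 : ℚ) ≤ n / q := by positivity
    linarith
  have h3 : (((Finset.Ioc 0 (n : ℤ)).filter fun t => t ≡ v [ZMOD q]).card : ℤ) = ⌊a⌋ - ⌊b⌋ := by
    rw [h2, max_eq_left]
    · simp [ha, hb]
    · have := Int.floor_le_floor hba
      simp only [ha, hb] at this
      push_cast at this ⊢
      linarith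
  have h4 : |(((Finset.Ioc 0 (n : ℤ)).filter fun t => t ≡ v [ZMOD q]).card : ℚ) - n / q| ≤ 1 := by
    have h5 : (((Finset.Ioc 0 (n : ℤ)).filter fun t => t ≡ v [ZMOD q]).card : ℚ) = ⌊a⌋ - ⌊b⌋ := by
      exact_mod_cast h3
    rw [h5, ← hab, abs_le]
    have := Int.floor_le a
    have := Int.floor_le b
    have := Int.lt_floor_add_one a
    have := Int.lt_floor_add_one b
    constructor <;> linarith
  have h6 := (Rat.cast_le (K := ℝ)).2 h4
  push_cast at h6
  exact h6

/-- A polynomial that does not vanish modulo the prime `p` has few zeros modulo `p` in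
`{1, …, n}`. -/
lemma card_dvd_eval_le (g : Polynomial ℤ) {p : ℕ} (hp : p.Prime)
    (hg : ∃ j, ¬ (p : ℤ) ∣ g.coeff j) (n : ℕ) :
    (countIn (Finset.Icc 1 (n : ℤ)) (fun t => (p : ℤ) ∣ g.eval t) : ℝ) ≤
      g.natDegree * (n / p + 1) := by
  classical
  rw [countIn_eq]
  have : Fact p.Prime := ⟨hp⟩
  set G := g.map (Int.castRingHom (ZMod p)) with hG
  have hG0 : G ≠ 0 := by
    obtain ⟨j, hj⟩ := hg
    intro h
    apply hj
    have : G.coeff j = 0 := by rw [h]; simp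
    rw [hG, Polynomial.coeff_map] at this
    exact (ZMod.intCast_zmod_eq_zero_iff_dvd _ _).1 (by simpa using this)
  have hmaps : ∀ t ∈ (Finset.Icc 1 (n : ℤ)).filter (fun t => (p : ℤ) ∣ g.eval t),
      (t : ZMod p) ∈ G.roots.toFinset := by
    intro t ht
    rw [Multiset.mem_toFinset, Polynomial.mem_roots hG0, Polynomial.IsRoot.def, hG]
    have := (ZMod.intCast_zmod_eq_zero_iff_dvd _ p).2 (Finset.mem_filter.1 ht).2
    rw [Polynomial.eval_intCast_map]
    simpa using this
  rw [Finset.card_eq_sum_card_fiberwise hmaps]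
  push_cast
  have hfib : ∀ b ∈ G.roots.toFinset,
      ((((Finset.Icc 1 (n : ℤ)).filter (fun t => (p : ℤ) ∣ g.eval t)).filter
        (fun t : ℤ => (t : ZMod p) = b)).card : ℝ) ≤ n / p + 1 := by
    intro b _
    have h1 := (abs_le.1 (abs_card_modEq_sub_le n hp.pos (b.val : ℤ))).2
    refine le_trans ?_ (by linarith : (countIn (Finset.Icc 1 (n : ℤ))
      (fun t => t ≡ (b.val : ℤ) [ZMOD p]) : ℝ) ≤ n / p + 1)
    rw [countIn_eq]
    exact_mod_cast Finset.card_le_card fun t ht => by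
      simp only [Finset.mem_filter] at ht ⊢
      refine ⟨ht.1.1, (ZMod.intCast_eq_intCast_iff _ _ _).1 ?_⟩
      rw [ht.2]; simp
  refine (Finset.sum_le_card_nsmul _ _ _ hfib).trans ?_
  rw [nsmul_eq_mul]
  have hc : G.roots.toFinset.card ≤ g.natDegree :=
    (Multiset.toFinset_card_le _).trans ((Polynomial.card_roots' G).trans
      Polynomial.natDegree_map_le)
  gcongr

/-! ### Common zeros modulo a prime -/

open Classical in
/-- The polynomials in the last `s` variables that occur as the nonzero coefficients of the members
of `F`, regarded as polynomials in the first variable. -/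
noncomputable def coeffFamily {s : ℕ} (F : Finset (MvPolynomial (Fin (s + 1)) ℤ)) :
    Finset (MvPolynomial (Fin s) ℤ) :=
  F.biUnion fun f => (MvPolynomial.finSuccEquiv ℤ s f).coeffs

lemma coeff_mem_coeffFamily {s : ℕ} {F : Finset (MvPolynomial (Fin (s + 1)) ℤ)}
    {f : MvPolynomial (Fin (s + 1)) ℤ} (hf : f ∈ F) {j : ℕ}
    (hj : (MvPolynomial.finSuccEquiv ℤ s f).coeff j ≠ 0) :
    (MvPolynomial.finSuccEquiv ℤ s f).coeff j ∈ coeffFamily F :=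
  Finset.mem_biUnion.2 ⟨f, hf, Polynomial.coeff_mem_coeffs hj⟩

/-- The family `F` has a nonzero member, and its common factors are constants. -/
def NoCommonFactor {s : ℕ} (F : Finset (MvPolynomial (Fin s) ℤ)) : Prop :=
  (∃ f ∈ F, f ≠ 0) ∧ ∀ g : MvPolynomial (Fin s) ℤ, (∀ f ∈ F, g ∣ f) → g.totalDegree = 0

lemma eval_cons {s : ℕ} (f : MvPolynomial (Fin (s + 1)) ℤ) (t : ℤ) (x : Fin s → ℤ) :
    MvPolynomial.eval (Fin.cons t x : Fin (s + 1) → ℤ) f =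
      ((MvPolynomial.finSuccEquiv ℤ s f).map (MvPolynomial.eval x)).eval t :=
  MvPolynomial.eval_eq_eval_mv_eval' x t f

/-- A common factor of the coefficients is a common factor of the family. -/
lemma noCommonFactor_coeffFamily {s : ℕ} {F : Finset (MvPolynomial (Fin (s + 1)) ℤ)}
    (hF : NoCommonFactor F) : NoCommonFactor (coeffFamily F) := by
  refine ⟨?_, fun g hg => ?_⟩
  · obtain ⟨f, hf, hf0⟩ := hF.1
    have h0 : MvPolynomial.finSuccEquiv ℤ s f ≠ 0 := by simpa using hf0
    have h1 := Polynomial.leadingCoeff_ne_zero.2 h0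
    exact ⟨_, coeff_mem_coeffFamily hf h1, h1⟩
  · have h1 : ∀ f ∈ F, (MvPolynomial.finSuccEquiv ℤ s).symm (Polynomial.C g) ∣ f := by
      intro f hf
      have h2 : Polynomial.C g ∣ MvPolynomial.finSuccEquiv ℤ s f := by
        rw [Polynomial.C_dvd_iff_dvd_coeff]
        intro j
        by_cases hj : (MvPolynomial.finSuccEquiv ℤ s f).coeff j = 0
        · rw [hj]; exact dvd_zero _
        · exact hg _ (coeff_mem_coeffFamily hf hj)
      simpa using map_dvd (MvPolynomial.finSuccEquiv ℤ s).symm h2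
    have h2 := hF.2 _ h1
    by_cases hg0 : g = 0
    · simp [hg0]
    have h3 := MvPolynomial.totalDegree_coeff_finSuccEquiv_add_le
      ((MvPolynomial.finSuccEquiv ℤ s).symm (Polynomial.C g)) 0 (by simpa using hg0)
    rw [h2] at h3
    simpa using h3

/-- Elimination of the first variable: a nonzero polynomial in the remaining variables lies in the
ideal generated by `F`, so its value is divisible by every common divisor of the values of `F`. -/
lemma NoCommonFactor.exists_eliminant {s : ℕ} {F : Finset (MvPolynomial (Fin (s + 1)) ℤ)}
    (hF : NoCommonFactor F) :
    ∃ D : MvPolynomial (Fin s) ℤ, D ≠ 0 ∧ ∀ (d t : ℤ) (x : Fin s → ℤ),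
      (∀ f ∈ F, d ∣ MvPolynomial.eval (Fin.cons t x : Fin (s + 1) → ℤ) f) →
        d ∣ MvPolynomial.eval x D := by
  classical
  obtain ⟨D, hD, hDm⟩ := exists_C_mem_span (MvPolynomial.finSuccEquiv ℤ s '' (F : Set _))
    (by
      obtain ⟨f, hf, hf0⟩ := hF.1
      exact ⟨_, ⟨f, hf, rfl⟩, by simpa using hf0⟩)
    (by
      intro g hg
      have h1 : ((MvPolynomial.finSuccEquiv ℤ s).symm g).totalDegree = 0 := by
        refine hF.2 _ fun f hf => ?_
        simpa using map_dvd (MvPolynomial.finSuccEquiv ℤ s).symm (hg _ ⟨f, hf, rfl⟩)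
      have h2 := MvPolynomial.natDegree_finSuccEquiv ((MvPolynomial.finSuccEquiv ℤ s).symm g)
      rw [AlgEquiv.apply_symm_apply] at h2
      rw [h2]
      exact Nat.le_zero.1 ((MvPolynomial.degreeOf_le_totalDegree _ _).trans h1.le))
  refine ⟨D, hD, fun d t x h => ?_⟩
  let φ : Polynomial (MvPolynomial (Fin s) ℤ) →+* ℤ :=
    (Polynomial.evalRingHom t).comp (Polynomial.mapRingHom (MvPolynomial.eval x))
  have hle : Ideal.span (MvPolynomial.finSuccEquiv ℤ s '' (F : Set _)) ≤
      (Ideal.span {d}).comap φ := by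
    rw [Ideal.span_le]
    rintro _ ⟨f, hf, rfl⟩
    have := h f hf
    rw [eval_cons] at this
    exact Ideal.mem_span_singleton.2 this
  have := Ideal.mem_span_singleton.1 (hle hDm)
  simpa [φ] using this

/-- The congruence `D ≡ 0` modulo `p` has a proportion of `O(1 / p)` solutions in a box of side
at least `p`. -/
lemma exists_card_dvd_eval_le {s : ℕ} {D : MvPolynomial (Fin s) ℤ} (hD : D ≠ 0) :
    ∃ C : ℝ, 0 ≤ C ∧ ∀ p n : ℕ, p.Prime → p ≤ n →
      (p : ℝ) * countIn (box s n) (fun x => (p : ℤ) ∣ MvPolynomial.eval x D) ≤ C * n ^ s := by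
  induction s with
  | zero =>
    obtain ⟨c, rfl⟩ := MvPolynomial.C_surjective (Fin 0) D
    have hc : c ≠ 0 := by rintro rfl; simp at hD
    refine ⟨|c|, by positivity, fun p n hp _ => ?_⟩
    by_cases h : (p : ℤ) ∣ c
    · have h1 : (p : ℤ) ≤ |c| := Int.le_of_dvd (by positivity) ((dvd_abs _ _).2 h)
      have h2 : (p : ℝ) ≤ |(c : ℝ)| := by exact_mod_cast h1
      simpa [h, countIn_true, card_box] using h2
    · rw [countIn_eq_zero]
      · simp
      · simp [h]
  | succ s ih =>
    set G := MvPolynomial.finSuccEquiv ℤ s D with hG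
    have hG0 : G ≠ 0 := by simpa [hG] using hD
    obtain ⟨C, hC0, hC⟩ := ih (Polynomial.leadingCoeff_ne_zero.2 hG0)
    refine ⟨C + 2 * G.natDegree, by positivity, fun p n hp hpn => ?_⟩
    have hp0 : (0 : ℝ) < p := by exact_mod_cast hp.pos
    have hpn' : (p : ℝ) ≤ n := by exact_mod_cast hpn
    have hnp : (1 : ℝ) ≤ n / p := (one_le_div hp0).2 hpn'
    have key := countIn_box_succ_le (s := s) (n := n)
      (fun x => (p : ℤ) ∣ MvPolynomial.eval x D)
      (fun x => (p : ℤ) ∣ MvPolynomial.eval x G.leadingCoeff) (fun _ => True)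
      (k := G.natDegree * (2 * (n / p))) (by positivity)
      (fun _ _ _ _ _ => Or.inr trivial) (by
        intro x _ hx
        have h1 := card_dvd_eval_le (G.map (MvPolynomial.eval x)) hp
          ⟨G.natDegree, by rw [Polynomial.coeff_map]; exact hx⟩ n
        simp only [eval_cons]
        refine h1.trans ?_
        have h2 : (((G.map (MvPolynomial.eval x)).natDegree : ℕ) : ℝ) ≤ G.natDegree := by
          exact_mod_cast Polynomial.natDegree_map_le
        gcongr
        linarith)
    rw [countIn_true, card_box] at key
    have h3 := hC p n hp hpn
    calc (p : ℝ) * _ ≤ p * _ := mul_le_mul_of_nonneg_left key hp0.le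
      _ = n * (p * countIn (box s n) (fun x => (p : ℤ) ∣ MvPolynomial.eval x G.leadingCoeff)) +
          2 * G.natDegree * n ^ (s + 1) := by
        push_cast; field_simp; ring
      _ ≤ n * (C * n ^ s) + 2 * G.natDegree * n ^ (s + 1) := by gcongr
      _ = _ := by ring

/-- A bound for the degrees in the first variable of the members of `F`. -/
lemma exists_natDegree_le {s : ℕ} (F : Finset (MvPolynomial (Fin (s + 1)) ℤ)) :
    ∃ d : ℕ, ∀ f ∈ F, ∀ x : Fin s → ℤ,
      ((MvPolynomial.finSuccEquiv ℤ s f).map (MvPolynomial.eval x)).natDegree ≤ d :=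
  ⟨F.sup fun f => (MvPolynomial.finSuccEquiv ℤ s f).natDegree, fun _ hf _ =>
    Polynomial.natDegree_map_le.trans
      (Finset.le_sup (f := fun f => (MvPolynomial.finSuccEquiv ℤ s f).natDegree) hf)⟩

/-- Over a point where not all coefficients of `F` vanish modulo `p`, the common zeros of `F`
modulo `p` are few. -/
lemma card_common_zero_fiber_le {s : ℕ} {F : Finset (MvPolynomial (Fin (s + 1)) ℤ)} {d : ℕ}
    (hd : ∀ f ∈ F, ∀ x : Fin s → ℤ,
      ((MvPolynomial.finSuccEquiv ℤ s f).map (MvPolynomial.eval x)).natDegree ≤ d)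
    {p : ℕ} (hp : p.Prime) (n : ℕ) {x : Fin s → ℤ}
    (hx : ¬ ∀ c ∈ coeffFamily F, (p : ℤ) ∣ MvPolynomial.eval x c) :
    (countIn (Finset.Icc 1 (n : ℤ)) (fun t => ∀ f ∈ F,
      (p : ℤ) ∣ MvPolynomial.eval (Fin.cons t x : Fin (s + 1) → ℤ) f) : ℝ) ≤
        d * (n / p + 1) := by
  classical
  push Not at hx
  obtain ⟨c, hc, hcx⟩ := hx
  obtain ⟨f, hf, hcf⟩ := Finset.mem_biUnion.1 hc
  obtain ⟨j, -, rfl⟩ := Polynomial.mem_coeffs_iff.1 hcf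
  have h1 := card_dvd_eval_le ((MvPolynomial.finSuccEquiv ℤ s f).map (MvPolynomial.eval x)) hp
    ⟨j, by rw [Polynomial.coeff_map]; exact hcx⟩ n
  have h2 : ((((MvPolynomial.finSuccEquiv ℤ s f).map (MvPolynomial.eval x)).natDegree : ℕ) : ℝ)
      ≤ d := by exact_mod_cast hd f hf x
  refine le_trans ?_ (h1.trans (by gcongr))
  exact_mod_cast countIn_mono fun t _ ht => by
    rw [← eval_cons]; exact ht f hf

/-- The common zeros modulo `p` of a family without common factor have codimension two: they are a
proportion of `O(1 / p ^ 2)` of a box of side at least `p`. -/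
lemma NoCommonFactor.exists_card_dvd_le {s : ℕ} {F : Finset (MvPolynomial (Fin s) ℤ)}
    (hF : NoCommonFactor F) :
    ∃ C : ℝ, 0 ≤ C ∧ ∀ p n : ℕ, p.Prime → p ≤ n →
      (p : ℝ) ^ 2 *
        countIn (box s n) (fun x => ∀ f ∈ F, (p : ℤ) ∣ MvPolynomial.eval x f) ≤
          C * n ^ s := by
  induction s with
  | zero =>
    obtain ⟨f, hf, hf0⟩ := hF.1
    obtain ⟨c, rfl⟩ := MvPolynomial.C_surjective (Fin 0) f
    have hc : c ≠ 0 := by rintro rfl; simp at hf0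
    refine ⟨(|c| : ℝ) ^ 2, by positivity, fun p n hp _ => ?_⟩
    by_cases h : (p : ℤ) ∣ c
    · have h1 : (p : ℤ) ≤ |c| := Int.le_of_dvd (by positivity) ((dvd_abs _ _).2 h)
      have h2 : (p : ℝ) ≤ |(c : ℝ)| := by exact_mod_cast h1
      have h3 : (countIn (box 0 n)
          (fun x => ∀ f ∈ F, (p : ℤ) ∣ MvPolynomial.eval x f) : ℝ) ≤ 1 := by
        have := countIn_le_card (box 0 n)
          (fun x => ∀ f ∈ F, (p : ℤ) ∣ MvPolynomial.eval x f)
        rw [card_box] at this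
        exact_mod_cast this
      simp only [pow_zero, mul_one]
      calc (p : ℝ) ^ 2 * _ ≤ |(c : ℝ)| ^ 2 * 1 := by gcongr
        _ = _ := mul_one _
    · rw [countIn_eq_zero]
      · simp; positivity
      · intro x _ hx
        exact h (by simpa using hx _ hf)
  | succ s ih =>
    obtain ⟨C, hC0, hC⟩ := ih (noCommonFactor_coeffFamily hF)
    obtain ⟨D, hD, hdvd⟩ := hF.exists_eliminant
    obtain ⟨B, hB0, hB⟩ := exists_card_dvd_eval_le hD
    obtain ⟨d, hd⟩ := exists_natDegree_le F
    refine ⟨C + 2 * d * B, by positivity, fun p n hp hpn => ?_⟩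
    have hp0 : (0 : ℝ) < p := by exact_mod_cast hp.pos
    have hpn' : (p : ℝ) ≤ n := by exact_mod_cast hpn
    have hnp : (1 : ℝ) ≤ n / p := (one_le_div hp0).2 hpn'
    have key := countIn_box_succ_le (s := s) (n := n)
      (fun x => ∀ f ∈ F, (p : ℤ) ∣ MvPolynomial.eval x f)
      (fun x => ∀ c ∈ coeffFamily F, (p : ℤ) ∣ MvPolynomial.eval x c)
      (fun x => (p : ℤ) ∣ MvPolynomial.eval x D)
      (k := d * (2 * (n / p))) (by positivity)
      (fun x _ t _ ht => Or.inr (hdvd p t x ht)) (by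
        intro x _ hx
        refine (card_common_zero_fiber_le hd hp n hx).trans ?_
        gcongr
        linarith)
    have h3 := hC p n hp hpn
    have h4 := hB p n hp hpn
    calc (p : ℝ) ^ 2 * _ ≤ p ^ 2 * _ := mul_le_mul_of_nonneg_left key (by positivity)
      _ = n * (p ^ 2 * countIn (box s n)
            (fun x => ∀ c ∈ coeffFamily F, (p : ℤ) ∣ MvPolynomial.eval x c)) +
          2 * d * n * (p * countIn (box s n) (fun x => (p : ℤ) ∣ MvPolynomial.eval x D)) := by
        field_simp
      _ ≤ n * (C * n ^ s) + 2 * d * n * (B * n ^ s) := by gcongr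
      _ = _ := by ring

/-! ### Large common prime divisors -/

/-- The integral zeros of a nonzero polynomial are a proportion of `O(1 / n)` of a box of side
`n`. -/
lemma exists_card_eval_eq_zero_le {s : ℕ} {D : MvPolynomial (Fin s) ℤ} (hD : D ≠ 0) :
    ∃ C : ℝ, 0 ≤ C ∧ ∀ n : ℕ,
      (n : ℝ) * countIn (box s n) (fun x => MvPolynomial.eval x D = 0) ≤ C * n ^ s := by
  classical
  refine ⟨D.totalDegree, by positivity, fun n => ?_⟩
  rcases n.eq_zero_or_pos with rfl | hn
  · simp; positivity
  have h := MvPolynomial.schwartz_zippel_totalDegree hD (Finset.Icc 1 (n : ℤ))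
  have hc : (Finset.Icc 1 (n : ℤ)).card = n := by simp
  rw [hc, div_le_div_iff₀ (by positivity) (by positivity)] at h
  rw [countIn_eq, box, mul_comm]
  exact_mod_cast h

lemma exists_abs_eval_le {s : ℕ} (D : MvPolynomial (Fin s) ℤ) :
    ∃ A δ : ℕ, ∀ n : ℕ, 1 ≤ n → ∀ x ∈ box s n, |MvPolynomial.eval x D| ≤ A * (n : ℤ) ^ δ := by
  induction D using MvPolynomial.induction_on with
  | C c => exact ⟨c.natAbs, 0, fun n _ x _ => by simp⟩
  | add f g hf hg =>
    obtain ⟨A, δ, h⟩ := hf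
    obtain ⟨B, ε, h'⟩ := hg
    refine ⟨A + B, δ + ε, fun n hn x hx => ?_⟩
    have hn' : (1 : ℤ) ≤ n := by exact_mod_cast hn
    have h1 : (n : ℤ) ^ δ ≤ (n : ℤ) ^ (δ + ε) := pow_le_pow_right₀ hn' (by omega)
    have h2 : (n : ℤ) ^ ε ≤ (n : ℤ) ^ (δ + ε) := pow_le_pow_right₀ hn' (by omega)
    rw [map_add]
    calc |_| ≤ _ := abs_add_le _ _
      _ ≤ A * (n : ℤ) ^ δ + B * (n : ℤ) ^ ε := add_le_add (h n hn x hx) (h' n hn x hx)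
      _ ≤ A * (n : ℤ) ^ (δ + ε) + B * (n : ℤ) ^ (δ + ε) := by gcongr
      _ = _ := by push_cast; ring
  | mul_X f i hf =>
    obtain ⟨A, δ, h⟩ := hf
    refine ⟨A, δ + 1, fun n hn x hx => ?_⟩
    have hxi := mem_box.1 hx i
    have h1 : |x i| ≤ n := by rw [abs_of_nonneg (by omega)]; exact hxi.2
    rw [map_mul, MvPolynomial.eval_X, abs_mul, pow_succ, ← mul_assoc]
    exact mul_le_mul (h n hn x hx) h1 (abs_nonneg _) (by positivity)

/-- An integer of polynomial size in `n` has a bounded number of prime factors exceeding `n`. -/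
lemma card_large_primeFactors_le {m : ℤ} (hm : m ≠ 0) {A δ n : ℕ} (hn : 1 ≤ n)
    (h : |m| ≤ A * (n : ℤ) ^ δ) : (m.natAbs.primeFactors.filter fun p => n < p).card ≤ δ + A := by
  set T := m.natAbs.primeFactors.filter fun p => n < p with hT
  by_contra! hlt
  obtain ⟨k, hk⟩ : ∃ k, T.card = δ + k := ⟨T.card - δ, by omega⟩
  have h1 : (n + 1) ^ T.card ≤ ∏ p ∈ T, p :=
    Finset.pow_card_le_prod _ _ _ fun p hp => (Finset.mem_filter.1 hp).2
  have h2 : ∏ p ∈ T, p ≤ m.natAbs := Nat.le_of_dvd (Int.natAbs_pos.2 hm)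
    ((Finset.prod_dvd_prod_of_subset _ _ _ (Finset.filter_subset _ _)).trans
      (Nat.prod_primeFactors_dvd _))
  have h3 : m.natAbs ≤ A * n ^ δ := by
    zify; simpa using h
  have h4 : A * n ^ δ ≤ A * (n + 1) ^ δ := by gcongr; omega
  have h5 : (n + 1) ^ δ * (n + 1) ^ k ≤ (n + 1) ^ δ * A := by
    rw [← pow_add, ← hk, mul_comm _ A]; omega
  have h6 : (n + 1) ^ k ≤ A := le_of_mul_le_mul_left h5 (by positivity)
  have h7 : 2 ^ k ≤ (n + 1) ^ k := Nat.pow_le_pow_left (by omega) k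
  have h8 : k < 2 ^ k := Nat.lt_two_pow_self
  omega

/-- Common prime divisors larger than the side of the box are rare. Outside the zero set of an
eliminant `D` of the first variable, such a prime divides the nonzero integer `D(x)` of polynomial
size, so that there are boundedly many candidates, each of which allows boundedly many values of
the first variable. -/
lemma NoCommonFactor.exists_card_large_prime_le {s : ℕ} {F : Finset (MvPolynomial (Fin s) ℤ)}
    (hF : NoCommonFactor F) :
    ∃ C : ℝ, 0 ≤ C ∧ ∀ n : ℕ, 1 ≤ n →
      (n : ℝ) * countIn (box s n)
        (fun x => ∃ p : ℕ, p.Prime ∧ n < p ∧ ∀ f ∈ F, (p : ℤ) ∣ MvPolynomial.eval x f) ≤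
          C * n ^ s := by
  induction s with
  | zero =>
    obtain ⟨f, hf, hf0⟩ := hF.1
    obtain ⟨c, rfl⟩ := MvPolynomial.C_surjective (Fin 0) f
    have hc : c ≠ 0 := by rintro rfl; simp at hf0
    refine ⟨|c|, by positivity, fun n _ => ?_⟩
    by_cases h : (n : ℤ) ≤ |c|
    · have h2 : (n : ℝ) ≤ |(c : ℝ)| := by exact_mod_cast h
      have h3 : (countIn (box 0 n) (fun x => ∃ p : ℕ, p.Prime ∧ n < p ∧
          ∀ f ∈ F, (p : ℤ) ∣ MvPolynomial.eval x f) : ℝ) ≤ 1 := by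
        have := countIn_le_card (box 0 n) (fun x => ∃ p : ℕ, p.Prime ∧ n < p ∧
          ∀ f ∈ F, (p : ℤ) ∣ MvPolynomial.eval x f)
        rw [card_box] at this
        exact_mod_cast this
      rw [pow_zero]
      exact mul_le_mul h2 h3 (by positivity) (by positivity)
    · rw [countIn_eq_zero]
      · simp
      · rintro x _ ⟨p, _, hnp, hp⟩
        have h1 : (p : ℤ) ∣ c := by simpa using hp _ hf
        have h2 : (p : ℤ) ≤ |c| := Int.le_of_dvd (by positivity) ((dvd_abs _ _).2 h1)
        omega
  | succ s ih =>
    obtain ⟨C, hC0, hC⟩ := ih (noCommonFactor_coeffFamily hF)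
    obtain ⟨D, hD, hdvd⟩ := hF.exists_eliminant
    obtain ⟨E, hE0, hE⟩ := exists_card_eval_eq_zero_le hD
    obtain ⟨d, hd⟩ := exists_natDegree_le F
    obtain ⟨A, δ, hA⟩ := exists_abs_eval_le D
    refine ⟨E + C + (δ + A) * (d * 2), by positivity, fun n hn => ?_⟩
    have hn0 : (0 : ℝ) < n := by exact_mod_cast hn
    have key := countIn_box_succ_le (s := s) (n := n)
      (fun x => ∃ p : ℕ, p.Prime ∧ n < p ∧ ∀ f ∈ F, (p : ℤ) ∣ MvPolynomial.eval x f)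
      (fun x => MvPolynomial.eval x D = 0 ∨
        ∃ p : ℕ, p.Prime ∧ n < p ∧ ∀ c ∈ coeffFamily F, (p : ℤ) ∣ MvPolynomial.eval x c)
      (fun x => True) (k := (δ + A) * (d * 2)) (by positivity)
      (fun _ _ _ _ _ => Or.inr trivial) (by
        intro x hx hnot
        push Not at hnot
        obtain ⟨hx0, hxp⟩ := hnot
        set T := (MvPolynomial.eval x D).natAbs.primeFactors.filter fun p => n < p with hT
        have hTc : (T.card : ℝ) ≤ δ + A := by
          exact_mod_cast card_large_primeFactors_le hx0 hn (hA n hn x hx)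
        have h1 : countIn (Finset.Icc 1 (n : ℤ)) (fun t => ∃ p : ℕ, p.Prime ∧ n < p ∧
            ∀ f ∈ F, (p : ℤ) ∣ MvPolynomial.eval (Fin.cons t x : Fin (s + 1) → ℤ) f) ≤
            countIn (Finset.Icc 1 (n : ℤ)) (fun t => ∃ p ∈ T,
              ∀ f ∈ F, (p : ℤ) ∣ MvPolynomial.eval (Fin.cons t x : Fin (s + 1) → ℤ) f) := by
          refine countIn_mono ?_
          rintro t _ ⟨p, hp, hnp, hpF⟩
          refine ⟨p, Finset.mem_filter.2 ⟨Nat.mem_primeFactors.2 ⟨hp, ?_, ?_⟩, hnp⟩, hpF⟩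
          · exact Int.natCast_dvd.1 (hdvd p t x hpF)
          · simpa using hx0
        have h2 := h1.trans (countIn_exists_le _ _ _)
        have h3 : ∀ p ∈ T, (countIn (Finset.Icc 1 (n : ℤ)) (fun t =>
            ∀ f ∈ F, (p : ℤ) ∣ MvPolynomial.eval (Fin.cons t x : Fin (s + 1) → ℤ) f) : ℝ) ≤
            d * 2 := by
          intro p hp
          rw [Finset.mem_filter, Nat.mem_primeFactors] at hp
          have hnx : ¬ ∀ c ∈ coeffFamily F, (p : ℤ) ∣ MvPolynomial.eval x c := by
            intro h
            obtain ⟨c, hc, hc'⟩ := hxp p hp.1.1 hp.2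
            exact hc' (h c hc)
          refine (card_common_zero_fiber_le hd hp.1.1 n hnx).trans ?_
          have h4 : (n : ℝ) / p ≤ 1 := by
            apply div_le_one_of_le₀ _ (by positivity)
            exact_mod_cast hp.2.le
          gcongr
          linarith
        calc (countIn (Finset.Icc 1 (n : ℤ)) (fun t => ∃ p : ℕ, p.Prime ∧ n < p ∧
            ∀ f ∈ F, (p : ℤ) ∣ MvPolynomial.eval (Fin.cons t x : Fin (s + 1) → ℤ) f) : ℝ)
            ≤ ∑ p ∈ T, (countIn (Finset.Icc 1 (n : ℤ)) (fun t => ∀ f ∈ F,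
              (p : ℤ) ∣ MvPolynomial.eval (Fin.cons t x : Fin (s + 1) → ℤ) f) : ℝ) := by
              exact_mod_cast h2
          _ ≤ T.card • ((d : ℝ) * 2) := Finset.sum_le_card_nsmul _ _ _ h3
          _ = T.card * ((d : ℝ) * 2) := nsmul_eq_mul _ _
          _ ≤ _ := by gcongr)
    rw [countIn_true, card_box] at key
    have h5 := countIn_or_le (box s n) (fun x => MvPolynomial.eval x D = 0)
      (fun x => ∃ p : ℕ, p.Prime ∧ n < p ∧
        ∀ c ∈ coeffFamily F, (p : ℤ) ∣ MvPolynomial.eval x c)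
    have h6 := (Nat.cast_le (α := ℝ)).2 h5
    push_cast at h6 key
    have h7 := hE n
    have h8 := hC n hn
    calc (n : ℝ) * _ ≤ n * _ := mul_le_mul_of_nonneg_left
          (key.trans (add_le_add_left (mul_le_mul_of_nonneg_left h6 hn0.le) _)) hn0.le
      _ = n * (n * countIn (box s n) (fun x => MvPolynomial.eval x D = 0)) +
          n * (n * countIn (box s n) (fun x => ∃ p : ℕ, p.Prime ∧ n < p ∧
            ∀ c ∈ coeffFamily F, (p : ℤ) ∣ MvPolynomial.eval x c)) +
          (δ + A) * (d * 2) * n ^ (s + 1) := by ring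
      _ ≤ n * (E * n ^ s) + n * (C * n ^ s) + (δ + A) * (d * 2) * n ^ (s + 1) := by gcongr
      _ = _ := by ring

/-- The values of a family without common factor rarely have a common prime divisor larger
than `M`. -/
lemma NoCommonFactor.exists_card_prime_gt_le {s : ℕ} {F : Finset (MvPolynomial (Fin s) ℤ)}
    (hF : NoCommonFactor F) :
    ∃ C : ℝ, 0 ≤ C ∧ ∀ M n : ℕ, 1 ≤ M → 1 ≤ n →
      (countIn (box s n)
        (fun x => ∃ p : ℕ, p.Prime ∧ M < p ∧ ∀ f ∈ F, (p : ℤ) ∣ MvPolynomial.eval x f) : ℝ) ≤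
          (C / M + C / n) * n ^ s := by
  obtain ⟨A, hA0, hA⟩ := hF.exists_card_dvd_le
  obtain ⟨B, hB0, hB⟩ := hF.exists_card_large_prime_le
  refine ⟨A + B, by positivity, fun M n hM hn => ?_⟩
  have hn0 : (0 : ℝ) < n := by exact_mod_cast hn
  have hM0 : (0 : ℝ) < M := by exact_mod_cast hM
  set T := (Finset.Ioc M n).filter Nat.Prime with hT
  have h1 : countIn (box s n)
      (fun x => ∃ p : ℕ, p.Prime ∧ M < p ∧ ∀ f ∈ F, (p : ℤ) ∣ MvPolynomial.eval x f) ≤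
      countIn (box s n) (fun x => (∃ p ∈ T, ∀ f ∈ F, (p : ℤ) ∣ MvPolynomial.eval x f) ∨
        ∃ p : ℕ, p.Prime ∧ n < p ∧ ∀ f ∈ F, (p : ℤ) ∣ MvPolynomial.eval x f) := by
    refine countIn_mono ?_
    rintro x _ ⟨p, hp, hMp, hpF⟩
    rcases le_or_gt p n with hpn | hpn
    · exact Or.inl ⟨p, Finset.mem_filter.2 ⟨Finset.mem_Ioc.2 ⟨hMp, hpn⟩, hp⟩, hpF⟩
    · exact Or.inr ⟨p, hp, hpn, hpF⟩
  have h2 := h1.trans ((countIn_or_le _ _ _).trans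
    (Nat.add_le_add_right (countIn_exists_le _ _ _) _))
  have h3 := (Nat.cast_le (α := ℝ)).2 h2
  push_cast at h3
  have h4 : ∑ p ∈ T, (countIn (box s n)
      (fun x => ∀ f ∈ F, (p : ℤ) ∣ MvPolynomial.eval x f) : ℝ) ≤ A / M * n ^ s := by
    calc _ ≤ ∑ p ∈ T, A * n ^ s * ((p : ℝ) ^ 2)⁻¹ := by
          refine Finset.sum_le_sum fun p hp => ?_
          rw [hT, Finset.mem_filter, Finset.mem_Ioc] at hp
          have hp0 : (0 : ℝ) < p := by exact_mod_cast hp.2.pos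
          rw [← div_eq_mul_inv, le_div_iff₀ (by positivity), mul_comm]
          exact hA p n hp.2 hp.1.2
      _ ≤ ∑ p ∈ Finset.Ioc M n, A * n ^ s * ((p : ℝ) ^ 2)⁻¹ :=
          Finset.sum_le_sum_of_subset_of_nonneg (Finset.filter_subset _ _)
            fun _ _ _ => by positivity
      _ = A * n ^ s * ∑ p ∈ Finset.Ioc M n, ((p : ℝ) ^ 2)⁻¹ := by rw [Finset.mul_sum]
      _ ≤ A * n ^ s * (M : ℝ)⁻¹ := by
          gcongr
          rcases le_or_gt M n with h | h
          · have := sum_Ioc_inv_sq_le_sub (α := ℝ) (by omega : M ≠ 0) h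
            have h5 : (0 : ℝ) ≤ (n : ℝ)⁻¹ := by positivity
            linarith
          · rw [Finset.Ioc_eq_empty (by omega)]
            simp
      _ = _ := by ring
  have h5 : (countIn (box s n) (fun x => ∃ p : ℕ, p.Prime ∧ n < p ∧
      ∀ f ∈ F, (p : ℤ) ∣ MvPolynomial.eval x f) : ℝ) ≤ B / n * n ^ s := by
    rw [div_mul_eq_mul_div, le_div_iff₀ hn0, mul_comm]
    exact hB n hn
  have h6 : A / M * (n : ℝ) ^ s ≤ (A + B) / M * n ^ s := by gcongr; linarith
  have h7 : B / n * (n : ℝ) ^ s ≤ (A + B) / n * n ^ s := by gcongr; linarith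
  rw [add_mul]
  linarith

/-! ### Divisibility and residues of integer adeles -/

lemma PadicInt.appr_eq_zero_iff {p : ℕ} [Fact p.Prime] (x : ℤ_[p]) (k : ℕ) :
    x.appr k = 0 ↔ (p : ℤ_[p]) ^ k ∣ x := by
  have h := Ideal.mem_span_singleton.1 (PadicInt.appr_spec k x)
  constructor
  · intro h0
    simpa [h0] using h
  · intro hx
    have h1 : (p : ℤ_[p]) ^ k ∣ ((x.appr k : ℤ) : ℤ_[p]) := by
      have := (dvd_sub_right hx).1 h
      exact_mod_cast this
    have h2 : p ^ k ∣ x.appr k := by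
      have := (PadicInt.pow_p_dvd_int_iff k _).1 h1
      exact_mod_cast this
    exact Nat.eq_zero_of_dvd_of_lt h2 (PadicInt.appr_lt x k)

namespace IntegerAdele

lemma appr_eq_zero_iff_digit (p : Nat.Primes) (x : IntegerAdele) (k : ℕ) :
    (x p).appr k = 0 ↔ ∀ j < k, digit p j x = 0 := by
  induction k with
  | zero => simp [PadicInt.appr]
  | succ k ih =>
    have hlt := PadicInt.appr_lt (x p) k
    have hmono := PadicInt.appr_mono (x p) (Nat.le_succ k)
    have hdvd := PadicInt.dvd_appr_sub_appr (x p) k (k + 1) (Nat.le_succ k)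
    have hpos : 0 < (p : ℕ) ^ k := pow_pos p.2.pos k
    rw [Nat.forall_lt_succ_right, ← ih]
    constructor
    · intro h
      refine ⟨Nat.le_zero.1 (h ▸ hmono), ?_⟩
      rw [digit, h, Nat.zero_div]
    · rintro ⟨h0, h1⟩
      rw [digit, Nat.div_eq_zero_iff_lt hpos] at h1
      rw [h0, Nat.sub_zero] at hdvd
      exact Nat.eq_zero_of_dvd_of_lt hdvd h1

lemma le_lambda_iff (p : Nat.Primes) (x : IntegerAdele) (k : ℕ) :
    (k : ℕ∞) ≤ lambda p x ↔ ((p : ℕ) : ℤ_[(p : ℕ)]) ^ k ∣ x p := by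
  rw [← PadicInt.appr_eq_zero_iff, appr_eq_zero_iff_digit, lambda, le_sInf_iff]
  constructor
  · intro h j hj
    by_contra hne
    have := h j ⟨j, rfl, Nat.pos_of_ne_zero hne⟩
    exact absurd (Nat.cast_le.1 this) (by omega)
  · rintro h _ ⟨j, rfl, hj⟩
    rw [Nat.cast_le]
    by_contra hlt
    exact hj.ne' (h j (by omega))

/-- Divisibility by a positive integer can be tested on prime powers. -/
lemma natCast_dvd_iff {q : ℕ} (hq : q ≠ 0) (y : IntegerAdele) :
    (q : IntegerAdele) ∣ y ↔
      ∀ (p : Nat.Primes) (k : ℕ), (p : ℕ) ^ k ∣ q → ((p : ℕ) : ℤ_[(p : ℕ)]) ^ k ∣ y p := by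
  constructor
  · rintro ⟨z, rfl⟩ p k hk
    have h1 : ((p : ℕ) : ℤ_[(p : ℕ)]) ^ k ∣ (q : ℤ_[(p : ℕ)]) := by
      have := Nat.cast_dvd_cast (α := ℤ_[(p : ℕ)]) hk
      simpa using this
    simpa using h1.mul_right (z p)
  · intro h
    have h1 : ∀ p : Nat.Primes, ∃ z : ℤ_[(p : ℕ)], y p = q * z := by
      intro p
      obtain ⟨k, m, hm, hqm⟩ := Nat.exists_eq_pow_mul_and_not_dvd hq p p.2.ne_one
      have hu : IsUnit (m : ℤ_[(p : ℕ)]) := by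
        rw [PadicInt.isUnit_iff]
        refine le_antisymm (PadicInt.norm_le_one _) (not_lt.1 fun hlt => hm ?_)
        have := (PadicInt.norm_int_lt_one_iff_dvd (p := p) (m : ℤ)).1 (by simpa using hlt)
        exact_mod_cast this
      have h2 := h p k ⟨m, hqm⟩
      have h3 : (q : ℤ_[(p : ℕ)]) ∣ y p := by
        rw [hqm]
        push_cast
        exact hu.mul_right_dvd.2 h2
      exact h3
    choose z hz using h1
    exact ⟨z, funext fun p => by simpa using hz p⟩

lemma natCast_dvd_intCast_iff {q : ℕ} (hq : q ≠ 0) (z : ℤ) :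
    (q : IntegerAdele) ∣ (z : IntegerAdele) ↔ (q : ℤ) ∣ z := by
  rw [natCast_dvd_iff hq, Int.natCast_dvd, Nat.dvd_iff_prime_pow_dvd_dvd]
  constructor
  · intro h p k hp hk
    have : Fact p.Prime := ⟨hp⟩
    have h1 : (p : ℤ_[p]) ^ k ∣ (z : ℤ_[p]) := h ⟨p, hp⟩ k hk
    have h2 := (PadicInt.pow_p_dvd_int_iff k z).1 h1
    exact Int.natCast_dvd.1 (by exact_mod_cast h2)
  · intro h p k hk
    have h1 := h p k p.2 hk
    have h2 : ((p : ℕ) ^ k : ℤ) ∣ z := by exact_mod_cast Int.natCast_dvd.2 h1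
    simpa using (PadicInt.pow_p_dvd_int_iff k z).2 h2

/-- Every integer adele is congruent to an integer modulo `q`, by the Chinese remainder theorem. -/
lemma exists_natCast_dvd_sub {q : ℕ} (hq : q ≠ 0) (x : IntegerAdele) :
    ∃ a : ℕ, a < q ∧ (q : IntegerAdele) ∣ x - (a : IntegerAdele) := by
  classical
  let d : Nat.Primes → ℕ := fun p => (x p).appr (q.factorization p)
  let c : ℕ → ℕ := fun p => if hp : p.Prime then d ⟨p, hp⟩ else 0
  let A := Nat.chineseRemainderOfFinset c (fun p => p ^ q.factorization p) q.primeFactors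
    (fun p hp => pow_ne_zero _ (Nat.prime_of_mem_primeFactors hp).ne_zero)
    (fun p hp r hr hpr => (Nat.coprime_primes (Nat.prime_of_mem_primeFactors hp)
      (Nat.prime_of_mem_primeFactors hr)).2 hpr |>.pow _ _)
  have hA : (q : IntegerAdele) ∣ x - ((A : ℕ) : IntegerAdele) := by
    rw [natCast_dvd_iff hq]
    intro p k hk
    rcases k.eq_zero_or_pos with rfl | hk0
    · simp
    have hpm : (p : ℕ) ∈ q.primeFactors :=
      Nat.mem_primeFactors.2 ⟨p.2, (dvd_pow_self _ hk0.ne').trans hk, hq⟩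
    have hkv : k ≤ q.factorization p := (p.2.pow_dvd_iff_le_factorization hq).1 hk
    refine (pow_dvd_pow _ hkv).trans ?_
    have h1 := A.2 p hpm
    have hc : c p = (x p).appr (q.factorization p) := dif_pos p.2
    rw [hc] at h1
    have h2 := Ideal.mem_span_singleton.1 (PadicInt.appr_spec (q.factorization p) (x p))
    have h3 : (((p : ℕ) ^ q.factorization p : ℕ) : ℤ) ∣
        ((x p).appr (q.factorization p) : ℤ) - ((A : ℕ) : ℤ) := (Nat.modEq_iff_dvd.1 h1)
    have h4 := (PadicInt.pow_p_dvd_int_iff (p := p) (q.factorization p)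
      (((x p).appr (q.factorization p) : ℤ) - ((A : ℕ) : ℤ))).2 (by exact_mod_cast h3)
    have h5 := dvd_add h2 h4
    push_cast at h5
    simpa using h5
  refine ⟨(A : ℕ) % q, Nat.mod_lt _ (Nat.pos_of_ne_zero hq), ?_⟩
  have h6 : (q : IntegerAdele) ∣ (((A : ℕ) : ℤ) - (((A : ℕ) % q : ℕ) : ℤ) : ℤ) := by
    rw [natCast_dvd_intCast_iff hq]
    exact (Nat.modEq_iff_dvd.1 (Nat.mod_modEq (A : ℕ) q))
  rw [Int.cast_sub, Int.cast_natCast, Int.cast_natCast] at h6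
  have h7 := dvd_add hA h6
  rwa [sub_add_sub_cancel] at h7

/-- The residue of an integer adele modulo `q` in `{0, …, q - 1}` (zero for `q = 0`). -/
noncomputable def residue (q : ℕ) (x : IntegerAdele) : ℕ :=
  if hq : q ≠ 0 then (exists_natCast_dvd_sub hq x).choose else 0

lemma residue_lt {q : ℕ} (hq : q ≠ 0) (x : IntegerAdele) : residue q x < q := by
  rw [residue, dif_pos hq]
  exact (exists_natCast_dvd_sub hq x).choose_spec.1

lemma dvd_sub_residue {q : ℕ} (hq : q ≠ 0) (x : IntegerAdele) :
    (q : IntegerAdele) ∣ x - (residue q x : IntegerAdele) := by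
  rw [residue, dif_pos hq]
  exact (exists_natCast_dvd_sub hq x).choose_spec.2

lemma residue_eq_iff {q : ℕ} (hq : q ≠ 0) (x : IntegerAdele) {a : ℕ} (ha : a < q) :
    residue q x = a ↔ (q : IntegerAdele) ∣ x - (a : IntegerAdele) := by
  constructor
  · rintro rfl
    exact dvd_sub_residue hq x
  · intro h
    have h1 := dvd_sub (dvd_sub_residue hq x) h
    have h2 : (q : IntegerAdele) ∣ (((a : ℤ) - (residue q x : ℤ) : ℤ) : IntegerAdele) := by
      push_cast
      simpa using h1
    have h3 : residue q x ≡ a [MOD q] :=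
      Nat.modEq_iff_dvd.2 ((natCast_dvd_intCast_iff hq _).1 h2)
    exact Nat.ModEq.eq_of_lt_of_lt h3 (residue_lt hq x) ha

lemma measurableSet_pow_dvd (p k : ℕ) [Fact p.Prime] :
    MeasurableSet {y : ℤ_[p] | (p : ℤ_[p]) ^ k ∣ y} := by
  have : {y : ℤ_[p] | (p : ℤ_[p]) ^ k ∣ y} = {y : ℤ_[p] | ‖y‖ ≤ (p : ℝ) ^ (-k : ℤ)} := by
    ext y
    rw [Set.mem_ofPred_eq, Set.mem_ofPred_eq, PadicInt.norm_le_pow_iff_mem_span_pow,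
      Ideal.mem_span_singleton]
  rw [this]
  exact (isClosed_le continuous_norm continuous_const).measurableSet

lemma measurableSet_natCast_dvd {q : ℕ} (hq : q ≠ 0) :
    MeasurableSet {y : IntegerAdele | (q : IntegerAdele) ∣ y} := by
  simp only [natCast_dvd_iff hq, Set.ofPred_forall]
  refine MeasurableSet.iInter fun p => MeasurableSet.iInter fun k =>
    MeasurableSet.iInter fun _ => ?_
  exact (measurableSet_pow_dvd (p : ℕ) k).preimage (measurable_pi_apply p)

lemma measurable_sub_natCast (a : ℕ) :
    Measurable fun x : IntegerAdele => x - (a : IntegerAdele) := by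
  refine measurable_pi_lambda _ fun p => ?_
  exact ((continuous_sub_right ((a : ℕ) : ℤ_[(p : ℕ)])).measurable).comp (measurable_pi_apply p)

lemma measurable_residue {q : ℕ} (hq : q ≠ 0) : Measurable (residue q) := by
  refine measurable_to_countable' fun a => ?_
  by_cases ha : a < q
  · have : residue q ⁻¹' {a} =
        (fun x : IntegerAdele => x - (a : IntegerAdele)) ⁻¹' {y | (q : IntegerAdele) ∣ y} := by
      ext x
      exact residue_eq_iff hq x ha
    rw [this]
    exact measurable_sub_natCast a (measurableSet_natCast_dvd hq)
  · convert! MeasurableSet.empty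
    ext x
    simp only [Set.mem_preimage, Set.mem_singleton_iff, Set.mem_empty_iff_false, iff_false]
    intro h
    exact ha (h ▸ residue_lt hq x)

instance haar_isProbabilityMeasure : IsProbabilityMeasure haar := by
  unfold haar; infer_instance

lemma map_sub_natCast_haar (a : ℕ) :
    haar.map (fun x : IntegerAdele => x - (a : IntegerAdele)) = haar := by
  unfold haar
  have h := Measure.infinitePi_map_pi (μ := fun p : Nat.Primes => padicHaar p)
    (f := fun p : Nat.Primes => fun y : ℤ_[(p : ℕ)] => y - ((a : ℕ) : ℤ_[(p : ℕ)]))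
    (fun p => (continuous_sub_right _).measurable)
  have h2 : ∀ p : Nat.Primes,
      (padicHaar p).map (fun y : ℤ_[(p : ℕ)] => y - ((a : ℕ) : ℤ_[(p : ℕ)])) = padicHaar p := by
    intro p
    have : (padicHaar p).IsAddHaarMeasure := by unfold padicHaar; infer_instance
    exact map_sub_right_eq_self _ _
  simp only [h2] at h
  exact h

/-- The residue of a Haar distributed integer adele is uniformly distributed on
`{0, …, q - 1}`: all residue classes are translates of one another. -/
lemma haar_residue_eq {q : ℕ} (hq : q ≠ 0) {a : ℕ} (ha : a < q) :
    haar.real {x | residue q x = a} = (q : ℝ)⁻¹ := by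
  have h1 : ∀ b < q, haar.real {x | residue q x = b} = haar.real {y | (q : IntegerAdele) ∣ y} := by
    intro b hb
    have h2 : {x | residue q x = b} =
        (fun x : IntegerAdele => x - (b : IntegerAdele)) ⁻¹' {y | (q : IntegerAdele) ∣ y} := by
      ext x
      exact residue_eq_iff hq x hb
    rw [h2, measureReal_def, measureReal_def,
      ← Measure.map_apply (measurable_sub_natCast b) (measurableSet_natCast_dvd hq),
      map_sub_natCast_haar]
  have h3 : haar.real (⋃ b ∈ Finset.range q, {x | residue q x = b}) =
      ∑ b ∈ Finset.range q, haar.real {x | residue q x = b} := by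
    refine measureReal_biUnion_finset ?_ fun b _ =>
      measurable_residue hq (measurableSet_singleton b)
    intro b _ c _ hbc
    refine Set.disjoint_left.2 fun x hx hx' => hbc ?_
    have h5 : residue q x = b := hx
    have h6 : residue q x = c := hx'
    exact h5.symm.trans h6
  have h4 : (⋃ b ∈ Finset.range q, {x | residue q x = b}) = Set.univ := by
    ext x
    simp [residue_lt hq x]
  rw [h4, probReal_univ, Finset.sum_congr rfl fun b hb => h1 b (Finset.mem_range.1 hb),
    Finset.sum_const, Finset.card_range, nsmul_eq_mul] at h3
  rw [h1 a ha]
  exact eq_inv_of_mul_eq_one_right h3.symm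

end IntegerAdele

/-! ### Equidistribution of residues -/

lemma MvPolynomial.dvd_aeval_sub {σ R : Type*} [CommRing R] {d : R} {u v : σ → R}
    (h : ∀ j, d ∣ u j - v j) (f : MvPolynomial σ ℤ) :
    d ∣ MvPolynomial.aeval u f - MvPolynomial.aeval v f := by
  induction f using MvPolynomial.induction_on with
  | C c => simp
  | add f g hf hg =>
    rw [map_add, map_add, add_sub_add_comm]
    exact dvd_add hf hg
  | mul_X f i hf =>
    rw [map_mul, map_mul, MvPolynomial.aeval_X, MvPolynomial.aeval_X]
    have : MvPolynomial.aeval u f * u i - MvPolynomial.aeval v f * v i =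
        (MvPolynomial.aeval u f - MvPolynomial.aeval v f) * u i +
          MvPolynomial.aeval v f * (u i - v i) := by ring
    rw [this]
    exact dvd_add (hf.mul_right _) ((h i).mul_left _)

namespace IntegerAdele

lemma aeval_intCast {s : ℕ} (f : MvPolynomial (Fin s) ℤ) (x : Fin s → ℤ) :
    MvPolynomial.aeval (fun j => (x j : IntegerAdele)) f =
      ((MvPolynomial.eval x f : ℤ) : IntegerAdele) := by
  have := MvPolynomial.aeval_algebraMap_apply (R := ℤ) (A := ℤ) (B := IntegerAdele) x f
  simpa [MvPolynomial.aeval_eq_eval, Function.comp_def] using this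

lemma aeval_apply {s : ℕ} (f : MvPolynomial (Fin s) ℤ) (v : Fin s → IntegerAdele)
    (p : Nat.Primes) :
    (MvPolynomial.aeval v f) p = MvPolynomial.aeval (fun j => v j p) f := by
  exact MvPolynomial.comp_aeval_apply v (Pi.evalAlgHom ℤ (fun p : Nat.Primes => ℤ_[(p : ℕ)]) p) f

/-- The divisibility of polynomial values by a divisor `d` of `q` only depends on the residues
modulo `q` of the arguments. -/
lemma natCast_dvd_aeval_iff {s : ℕ} {d q : ℕ} (hd : d ∣ q) (hq : q ≠ 0)
    (f : MvPolynomial (Fin s) ℤ) (v : Fin s → IntegerAdele) :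
    (d : IntegerAdele) ∣ MvPolynomial.aeval v f ↔
      (d : ℤ) ∣ MvPolynomial.eval (fun j => (residue q (v j) : ℤ)) f := by
  have hd0 : d ≠ 0 := ne_zero_of_dvd_ne_zero hq hd
  rw [← natCast_dvd_intCast_iff hd0, ← aeval_intCast]
  have h : (d : IntegerAdele) ∣ MvPolynomial.aeval v f -
      MvPolynomial.aeval (fun j => (((residue q (v j) : ℕ) : ℤ) : IntegerAdele)) f := by
    refine MvPolynomial.dvd_aeval_sub (fun j => ?_) f
    have h1 := (Nat.cast_dvd_cast (α := IntegerAdele) hd).trans (dvd_sub_residue hq (v j))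
    rwa [Int.cast_natCast]
  exact dvd_iff_dvd_of_dvd_sub h

lemma natCast_dvd_eval_iff {s : ℕ} {d q : ℕ} (hd : d ∣ q) (hq : q ≠ 0)
    (f : MvPolynomial (Fin s) ℤ) (x : Fin s → ℤ) :
    (d : ℤ) ∣ MvPolynomial.eval x f ↔
      (d : ℤ) ∣ MvPolynomial.eval (fun j => (residue q (x j : IntegerAdele) : ℤ)) f := by
  rw [← natCast_dvd_aeval_iff hd hq, aeval_intCast,
    natCast_dvd_intCast_iff (ne_zero_of_dvd_ne_zero hq hd)]

/-- The proportion of integer points of the box `{1, …, n} ^ s` in a given residue class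
modulo `q` converges to `1 / q ^ s`. -/
lemma tendsto_countIn_residue_eq {s q : ℕ} (hq : q ≠ 0) (a : Fin s → ℕ) (ha : ∀ j, a j < q) :
    Tendsto (fun n : ℕ => (countIn (box s n)
      (fun x => (fun j => residue q (x j : IntegerAdele)) = a) : ℝ) / n ^ s) atTop
      (𝓝 ((q : ℝ)⁻¹ ^ s)) := by
  classical
  have hcount : ∀ n : ℕ, countIn (box s n) (fun x => (fun j => residue q (x j : IntegerAdele)) = a)
      = ∏ j, countIn (Finset.Icc 1 (n : ℤ)) (fun t => t ≡ (a j : ℤ) [ZMOD q]) := by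
    intro n
    simp only [countIn_eq]
    rw [← Fintype.card_piFinset]
    congr 1
    ext x
    simp only [Finset.mem_filter, Fintype.mem_piFinset, mem_box, Finset.mem_Icc, funext_iff,
      forall_and]
    refine and_congr Iff.rfl (forall_congr' fun j => ?_)
    rw [residue_eq_iff hq _ (ha j), Int.modEq_comm, Int.modEq_iff_dvd,
      ← natCast_dvd_intCast_iff hq]
    push_cast
    rfl
  have hone : ∀ j, Tendsto (fun n : ℕ =>
      (countIn (Finset.Icc 1 (n : ℤ)) (fun t => t ≡ (a j : ℤ) [ZMOD q]) : ℝ) / n) atTop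
      (𝓝 ((q : ℝ)⁻¹)) := by
    intro j
    rw [tendsto_iff_norm_sub_tendsto_zero]
    refine squeeze_zero' (Eventually.of_forall fun _ => norm_nonneg _) ?_
      tendsto_one_div_atTop_nhds_zero_nat
    filter_upwards [eventually_gt_atTop 0] with n hn
    have hn' : (0 : ℝ) < n := by exact_mod_cast hn
    have h1 := abs_card_modEq_sub_le n (Nat.pos_of_ne_zero hq) (a j : ℤ)
    rw [Real.norm_eq_abs, le_div_iff₀ hn', ← abs_of_pos hn', ← abs_mul, abs_of_pos hn',
      sub_mul, div_mul_cancel₀ _ hn'.ne', inv_mul_eq_div]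
    exact h1
  have := tendsto_finsetProd Finset.univ fun j _ => hone j
  simp only [Finset.prod_const, Finset.card_univ, Fintype.card_fin] at this
  refine this.congr fun n => ?_
  rw [hcount, Finset.prod_div_distrib]
  simp

lemma countIn_eq_sum_residue {s q : ℕ} (hq : q ≠ 0) (S : Finset (Fin s → ℤ))
    (Q : (Fin s → ℕ) → Prop) [DecidablePred Q] :
    countIn S (fun x => Q fun j => residue q (x j : IntegerAdele)) =
      ∑ a ∈ (Fintype.piFinset fun _ : Fin s => Finset.range q).filter Q,
        countIn S (fun x => (fun j => residue q (x j : IntegerAdele)) = a) := by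
  classical
  simp only [countIn_eq]
  rw [Finset.card_eq_sum_card_fiberwise
    (f := fun (x : Fin s → ℤ) => fun j => residue q (x j : IntegerAdele))
    (t := (Fintype.piFinset fun _ : Fin s => Finset.range q).filter Q)]
  · refine Finset.sum_congr rfl fun a ha => ?_
    rw [Finset.filter_filter]
    congr 1
    refine Finset.filter_congr fun x _ => ?_
    constructor
    · exact fun h => h.2
    · rintro rfl
      exact ⟨(Finset.mem_filter.1 ha).2, rfl⟩
  · intro x hx
    rw [Finset.mem_coe, Finset.mem_filter] at hx ⊢
    exact ⟨by simp [residue_lt hq], hx.2⟩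

variable {Ω' : Type*} [MeasurableSpace Ω'] {P' : Measure Ω'} {s : ℕ}
  {V : Fin s → Ω' → IntegerAdele}

lemma measureReal_residue_eq (hV : ∀ j, HasLaw (V j) haar P') (hVindep : iIndepFun V P')
    {q : ℕ} (hq : q ≠ 0) (a : Fin s → ℕ) (ha : ∀ j, a j < q) :
    P'.real {ω | (fun j => residue q (V j ω)) = a} = (q : ℝ)⁻¹ ^ s := by
  have h1 := hVindep.measure_inter_preimage_eq_mul Finset.univ
    (sets := fun j => {x | residue q x = a j})
    fun j _ => measurable_residue hq (measurableSet_singleton (a j))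
  have h2 : {ω | (fun j => residue q (V j ω)) = a} =
      ⋂ j ∈ Finset.univ, V j ⁻¹' {x | residue q x = a j} := by
    ext ω; simp [funext_iff]
  rw [measureReal_def, h2, h1, ENNReal.toReal_prod]
  have h3 : ∀ j, (P' (V j ⁻¹' {x | residue q x = a j})).toReal = (q : ℝ)⁻¹ := by
    intro j
    have := (hV j).measure_eq (p := fun x => residue q x = a j)
      (measurable_residue hq (measurableSet_singleton (a j)))
    have h4 : P' (V j ⁻¹' {x | residue q x = a j}) = haar {x | residue q x = a j} := this
    rw [h4, ← measureReal_def, haar_residue_eq hq (ha j)]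
  rw [Finset.prod_congr rfl fun j _ => h3 j]
  simp

lemma measureReal_residue_mem [IsProbabilityMeasure P']
    (hV : ∀ j, HasLaw (V j) haar P') (hVindep : iIndepFun V P')
    {q : ℕ} (hq : q ≠ 0) (Q : (Fin s → ℕ) → Prop) [DecidablePred Q] :
    P'.real {ω | Q fun j => residue q (V j ω)} =
      ∑ _ ∈ (Fintype.piFinset fun _ : Fin s => Finset.range q).filter Q, (q : ℝ)⁻¹ ^ s := by
  have hR : AEMeasurable (fun ω j => residue q (V j ω)) P' :=
    aemeasurable_pi_lambda _ fun j => (measurable_residue hq).comp_aemeasurable (hV j).aemeasurable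
  have h1 : {ω | Q fun j => residue q (V j ω)} =
      ⋃ a ∈ (Fintype.piFinset fun _ : Fin s => Finset.range q).filter Q,
        {ω | (fun j => residue q (V j ω)) = a} := by
    ext ω
    simp only [Set.mem_ofPred_eq, Set.mem_iUnion, Finset.mem_filter, Fintype.mem_piFinset,
      Finset.mem_range, exists_prop]
    constructor
    · intro h
      exact ⟨_, ⟨fun j => residue_lt hq _, h⟩, rfl⟩
    · rintro ⟨a, ⟨_, h⟩, rfl⟩
      exact h
  rw [h1, measureReal_def, measure_biUnion_finset₀, ENNReal.toReal_sum]
  · refine Finset.sum_congr rfl fun a ha => ?_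
    rw [Finset.mem_filter, Fintype.mem_piFinset] at ha
    exact measureReal_residue_eq hV hVindep hq a fun j => Finset.mem_range.1 (ha.1 j)
  · exact fun a _ => measure_ne_top _ _
  · intro a _ b _ hab
    refine Disjoint.aedisjoint (Set.disjoint_left.2 fun ω h h' => hab ?_)
    have h3 : (fun j => residue q (V j ω)) = a := h
    have h4 : (fun j => residue q (V j ω)) = b := h'
    exact h3.symm.trans h4
  · exact fun a _ => hR.nullMeasurableSet_preimage (measurableSet_singleton a)

/-- Equidistribution: the residues modulo `q` of a random point of the box `{1, …, n} ^ s` converge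
in law to the residues of independent Haar distributed integer adeles. -/
lemma tendsto_countIn_residue [IsProbabilityMeasure P']
    (hV : ∀ j, HasLaw (V j) haar P') (hVindep : iIndepFun V P')
    {q : ℕ} (hq : q ≠ 0) (Q : (Fin s → ℕ) → Prop) :
    Tendsto (fun n : ℕ => (countIn (box s n)
      (fun x => Q fun j => residue q (x j : IntegerAdele)) : ℝ) / n ^ s) atTop
      (𝓝 (P'.real {ω | Q fun j => residue q (V j ω)})) := by
  classical
  rw [measureReal_residue_mem hV hVindep hq]
  refine (tendsto_finsetSum _ fun a ha => tendsto_countIn_residue_eq hq a fun j => ?_).congr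
    fun n => ?_
  · rw [Finset.mem_filter, Fintype.mem_piFinset] at ha
    exact Finset.mem_range.1 (ha.1 j)
  · rw [countIn_eq_sum_residue hq, ← Finset.sum_div]
    push_cast
    rfl

end IntegerAdele

/-! ### Minimal valuations of polynomial values at random integer adeles -/

/-- The zero set of a nonzero polynomial over an integral domain is a null set for every power of a
measure without atoms, by Fubini's theorem. -/
lemma MvPolynomial.pi_setOf_eval_eq_zero {R : Type*} [CommRing R] [IsDomain R] [TopologicalSpace R]
    [IsTopologicalRing R] [T1Space R] [SecondCountableTopology R] [MeasurableSpace R] [BorelSpace R]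
    (μ : Measure R) [SigmaFinite μ] [NullSingletonClass μ] {s : ℕ} {f : MvPolynomial (Fin s) R}
    (hf : f ≠ 0) : Measure.pi (fun _ : Fin s => μ) {x | MvPolynomial.eval x f = 0} = 0 := by
  induction s with
  | zero =>
    obtain ⟨c, rfl⟩ := MvPolynomial.C_surjective (Fin 0) f
    have hc : c ≠ 0 := by rintro rfl; simp at hf
    simp [hc]
  | succ s ih =>
    set G := MvPolynomial.finSuccEquiv R s f with hG
    have hG0 : G ≠ 0 := by simpa [hG] using hf
    have hmeas : MeasurableSet {x : Fin (s + 1) → R | MvPolynomial.eval x f = 0} :=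
      (isClosed_singleton.preimage (MvPolynomial.continuous_eval f)).measurableSet
    have hmp := (measurePreserving_piFinSuccAbove (fun _ : Fin (s + 1) => μ) 0).symm
    rw [← hmp.measure_preimage hmeas.nullMeasurableSet,
      Measure.prod_apply_symm (hmp.measurable hmeas), lintegral_eq_zero_iff
        (measurable_measure_prodMk_right (hmp.measurable hmeas))]
    have h1 : ∀ᵐ x ∂(Measure.pi fun _ : Fin s => μ), MvPolynomial.eval x G.leadingCoeff ≠ 0 :=
      ae_iff.2 (by simpa using ih (Polynomial.leadingCoeff_ne_zero.2 hG0))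
    filter_upwards [h1] with x hx
    have h2 : G.map (MvPolynomial.eval x) ≠ 0 := by
      intro h
      apply hx
      have := congrArg (fun P => Polynomial.coeff P G.natDegree) h
      simpa [Polynomial.coeff_map] using this
    classical
    refine measure_mono_null (fun t ht => ?_)
      ((G.map (MvPolynomial.eval x)).roots.toFinset.finite_toSet.measure_zero μ)
    rw [Finset.mem_coe, Multiset.mem_toFinset, Polynomial.mem_roots h2, Polynomial.IsRoot.def,
      ← MvPolynomial.eval_eq_eval_mv_eval', ← Fin.insertNth_zero']
    exact ht

namespace IntegerAdele

instance padicHaar_nullSingletonClass (p : ℕ) [hp : Fact p.Prime] :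
    NullSingletonClass (padicHaar p) := by
  have hnb : (𝓝[≠] (0 : ℤ_[p])).NeBot := by
    have h1 : Tendsto (fun n : ℕ => (p : ℤ_[p]) ^ n) atTop (𝓝 0) := by
      refine tendsto_pow_atTop_nhds_zero_of_norm_lt_one ?_
      exact (PadicInt.norm_lt_one_iff_dvd _).2 dvd_rfl
    have h2 : ∀ n : ℕ, (p : ℤ_[p]) ^ n ∈ ({0}ᶜ : Set ℤ_[p]) := fun n =>
      pow_ne_zero n (by exact_mod_cast hp.out.ne_zero)
    exact (tendsto_nhdsWithin_iff.2 ⟨h1, Eventually.of_forall h2⟩).neBot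
  unfold padicHaar
  infer_instance

/-- At the primes other than `p`, the integer `p ^ k` is a unit. -/
lemma natCast_pow_dvd_iff (p : Nat.Primes) (k : ℕ) (y : IntegerAdele) :
    (((p : ℕ) ^ k : ℕ) : IntegerAdele) ∣ y ↔ ((p : ℕ) : ℤ_[(p : ℕ)]) ^ k ∣ y p := by
  rw [natCast_dvd_iff (pow_ne_zero _ p.2.ne_zero)]
  constructor
  · exact fun h => h p k dvd_rfl
  · intro h r j hj
    rcases j.eq_zero_or_pos with rfl | hj0
    · simp
    have hrp : (r : ℕ) = p := (Nat.prime_dvd_prime_iff_eq r.2 p.2).1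
      (r.2.dvd_of_dvd_pow ((dvd_pow_self _ hj0.ne').trans hj))
    obtain rfl : r = p := Subtype.ext hrp
    exact (pow_dvd_pow _ ((Nat.pow_dvd_pow_iff_le_right r.2.one_lt).1 hj)).trans h

/-- The minimum of the `p`-adic valuations of the values of the family `f` at `v` (infinite if all
values have vanishing `p`-component). -/
noncomputable def minLambda {s m : ℕ} (f : Fin m → MvPolynomial (Fin s) ℤ) (p : Nat.Primes)
    (v : Fin s → IntegerAdele) : ℕ∞ :=
  ⨅ i, lambda p (MvPolynomial.aeval v (f i))

lemma le_minLambda_iff {s m : ℕ} (f : Fin m → MvPolynomial (Fin s) ℤ) (p : Nat.Primes)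
    (v : Fin s → IntegerAdele) (k : ℕ) :
    (k : ℕ∞) ≤ minLambda f p v ↔
      ∀ i, (((p : ℕ) ^ k : ℕ) : IntegerAdele) ∣ MvPolynomial.aeval v (f i) := by
  simp only [minLambda, le_iInf_iff, le_lambda_iff, natCast_pow_dvd_iff]

lemma measurableSet_natCast_dvd_aeval {s q : ℕ} (hq : q ≠ 0) (f : MvPolynomial (Fin s) ℤ) :
    MeasurableSet {v : Fin s → IntegerAdele | (q : IntegerAdele) ∣ MvPolynomial.aeval v f} := by
  have hR : Measurable fun (v : Fin s → IntegerAdele) j => residue q (v j) :=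
    measurable_pi_lambda _ fun j => (measurable_residue hq).comp (measurable_pi_apply j)
  have h := hR (Set.to_countable
    {a : Fin s → ℕ | (q : ℤ) ∣ MvPolynomial.eval (fun j => (a j : ℤ)) f}).measurableSet
  convert! h using 1
  ext v
  exact natCast_dvd_aeval_iff dvd_rfl hq f v

lemma measurable_toNat_minLambda {s m : ℕ} (f : Fin m → MvPolynomial (Fin s) ℤ) (p : Nat.Primes) :
    Measurable fun v : Fin s → IntegerAdele => (minLambda f p v).toNat := by
  have h1 : ∀ k : ℕ, MeasurableSet {v : Fin s → IntegerAdele | (k : ℕ∞) ≤ minLambda f p v} := by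
    intro k
    simp only [le_minLambda_iff, Set.ofPred_forall]
    exact MeasurableSet.iInter fun i =>
      measurableSet_natCast_dvd_aeval (pow_ne_zero _ p.2.ne_zero) (f i)
  have h2 : ∀ a : ℕ∞, MeasurableSet {v : Fin s → IntegerAdele | minLambda f p v = a} := by
    intro a
    induction a using ENat.recTopCoe with
    | top =>
      have : {v : Fin s → IntegerAdele | minLambda f p v = ⊤} =
          ⋂ k : ℕ, {v : Fin s → IntegerAdele | (k : ℕ∞) ≤ minLambda f p v} := by
        ext v
        simp only [Set.mem_ofPred_eq, Set.mem_iInter]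
        exact ENat.eq_top_iff_forall_ge
      rw [this]
      exact MeasurableSet.iInter h1
    | coe k =>
      have : {v : Fin s → IntegerAdele | minLambda f p v = k} =
          {v : Fin s → IntegerAdele | (k : ℕ∞) ≤ minLambda f p v} \
            {v : Fin s → IntegerAdele | ((k + 1 : ℕ) : ℕ∞) ≤ minLambda f p v} := by
        ext v
        simp only [Set.mem_ofPred_eq, Set.mem_sdiff, not_le]
        rw [Nat.cast_add, Nat.cast_one, ENat.lt_add_one_iff (ENat.natCast_ne_top k)]
        exact ⟨fun h => ⟨h.ge, h.le⟩, fun h => le_antisymm h.2 h.1⟩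
      rw [this]
      exact (h1 k).diff (h1 (k + 1))
  refine measurable_to_countable' fun k => ?_
  have h3 : (fun v : Fin s → IntegerAdele => (minLambda f p v).toNat) ⁻¹' {k} =
      ⋃ a ∈ {a : ℕ∞ | a.toNat = k}, {v : Fin s → IntegerAdele | minLambda f p v = a} := by
    ext v
    simp
  rw [h3]
  exact MeasurableSet.biUnion (Set.to_countable _) fun a _ => h2 a

variable {Ω' : Type*} [MeasurableSpace Ω'] {P' : Measure Ω'} {s m : ℕ}
  {V : Fin s → Ω' → IntegerAdele}

lemma ae_aeval_apply_ne_zero (hV : ∀ j, HasLaw (V j) haar P') (hVindep : iIndepFun V P')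
    (p : Nat.Primes) {f : MvPolynomial (Fin s) ℤ} (hf : f ≠ 0) :
    ∀ᵐ ω ∂P', (MvPolynomial.aeval (fun j => V j ω) f) p ≠ 0 := by
  have hmeas : ∀ j, AEMeasurable (fun ω => V j ω p) P' := fun j =>
    (measurable_pi_apply p).comp_aemeasurable (hV j).aemeasurable
  have hmap : ∀ j, P'.map (fun ω => V j ω p) = padicHaar p := by
    intro j
    have h1 := AEMeasurable.map_map_of_aemeasurable
      (g := fun x : IntegerAdele => x p) (measurable_pi_apply p).aemeasurable (hV j).aemeasurable
    rw [(hV j).map_eq, haar, Measure.infinitePi_map_eval] at h1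
    exact h1.symm
  have hind : iIndepFun (fun j ω => V j ω p) P' :=
    hVindep.comp (fun _ (x : IntegerAdele) => x p) fun _ => measurable_pi_apply p
  have hlaw := hind.map_fun_eq_pi_map hmeas
  simp only [hmap] at hlaw
  set g := MvPolynomial.map (algebraMap ℤ ℤ_[(p : ℕ)]) f with hg
  have hg0 : g ≠ 0 := fun h => hf (MvPolynomial.map_injective _
    (algebraMap ℤ ℤ_[(p : ℕ)]).injective_int (h.trans (map_zero _).symm))
  have h0 := MvPolynomial.pi_setOf_eval_eq_zero (padicHaar p) hg0
  rw [← hlaw] at h0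
  have h2 := ae_of_ae_map (aemeasurable_pi_lambda _ hmeas) (p := fun x => MvPolynomial.eval x g ≠ 0)
    (ae_iff.2 (by simpa using h0))
  filter_upwards [h2] with ω hω
  rw [aeval_apply, MvPolynomial.aeval_def, MvPolynomial.eval₂_eq_eval_map]
  exact hω

/-- The bound for the common zeros modulo `p` in boxes passes to the limit. -/
lemma exists_measureReal_dvd_le [IsProbabilityMeasure P']
    (hV : ∀ j, HasLaw (V j) haar P') (hVindep : iIndepFun V P')
    {f : Fin m → MvPolynomial (Fin s) ℤ} (hF : NoCommonFactor (Finset.univ.image f)) :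
    ∃ C : ℝ, 0 ≤ C ∧ ∀ p : Nat.Primes,
      P'.real {ω | 1 ≤ minLambda f p fun j => V j ω} ≤ C * (1 / ((p : ℕ) : ℝ) ^ 2) := by
  obtain ⟨C, hC0, hC⟩ := hF.exists_card_dvd_le
  refine ⟨C, hC0, fun p => ?_⟩
  have hp0 : (0 : ℝ) < (p : ℕ) := by exact_mod_cast p.2.pos
  have h := tendsto_countIn_residue hV hVindep p.2.ne_zero
    fun a => ∀ i, ((p : ℕ) : ℤ) ∣ MvPolynomial.eval (fun j => (a j : ℤ)) (f i)
  have h1 : {ω | 1 ≤ minLambda f p fun j => V j ω} = {ω | ∀ i, ((p : ℕ) : ℤ) ∣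
      MvPolynomial.eval (fun j => (residue p (V j ω) : ℤ)) (f i)} := by
    ext ω
    have := le_minLambda_iff f p (fun j => V j ω) 1
    rw [Nat.cast_one, pow_one] at this
    simp only [Set.mem_ofPred_eq, this,
      natCast_dvd_aeval_iff (dvd_refl (p : ℕ)) p.2.ne_zero]
  rw [h1]
  refine le_of_tendsto h ?_
  filter_upwards [eventually_ge_atTop (p : ℕ)] with n hn
  have hn0 : (0 : ℝ) < n := by exact_mod_cast p.2.pos.trans_le hn
  have h2 := hC p n p.2 hn
  rw [div_le_iff₀ (by positivity), mul_one_div, div_mul_eq_mul_div, le_div_iff₀ (by positivity),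
    mul_comm]
  refine le_trans (mul_le_mul_of_nonneg_left (Nat.cast_le.2 (countIn_mono ?_)) (by positivity)) h2
  intro x _ hx g hg
  obtain ⟨i, -, rfl⟩ := Finset.mem_image.1 hg
  exact (natCast_dvd_eval_iff (dvd_refl (p : ℕ)) p.2.ne_zero (f i) x).2 (hx i)

lemma ae_finite_one_le_minLambda [IsProbabilityMeasure P']
    (hV : ∀ j, HasLaw (V j) haar P') (hVindep : iIndepFun V P')
    {f : Fin m → MvPolynomial (Fin s) ℤ} (hF : NoCommonFactor (Finset.univ.image f)) :
    ∀ᵐ ω ∂P', {p : Nat.Primes | 1 ≤ minLambda f p fun j => V j ω}.Finite := by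
  obtain ⟨C, hC0, hC⟩ := exists_measureReal_dvd_le hV hVindep hF
  refine ae_finite_setOfPred_mem (s := fun p : Nat.Primes =>
    {ω | 1 ≤ minLambda f p fun j => V j ω}) ?_
  have hsum : Summable fun p : Nat.Primes => C * (1 / ((p : ℕ) : ℝ) ^ 2) :=
    ((Real.summable_one_div_nat_pow.2 one_lt_two).comp_injective
      Nat.Primes.coe_nat_injective).mul_left C
  refine ne_top_of_le_ne_top hsum.tsum_ofReal_ne_top (ENNReal.tsum_le_tsum fun p => ?_)
  rw [← ofReal_measureReal]
  exact ENNReal.ofReal_le_ofReal (hC p)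

end IntegerAdele

/-! ### The limit variable -/

lemma dvd_absGCD_iff {m : ℕ} (a : Fin m → ℤ) (d : ℕ) : d ∣ absGCD a ↔ ∀ i, (d : ℤ) ∣ a i := by
  simp [absGCD, Finset.dvd_gcd_iff, Int.natCast_dvd]

/-- The positive integer with prescribed exponents at the primes, almost all of them zero. If
infinitely many exponents are positive, the value is `1`. -/
noncomputable def primeProd (l : Nat.Primes → ℕ) : ℕ := ∏ᶠ p : Nat.Primes, (p : ℕ) ^ l p

lemma primeProd_eq_prod {l : Nat.Primes → ℕ} {S : Finset Nat.Primes} (hS : ∀ p ∉ S, l p = 0) :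
    primeProd l = ∏ p ∈ S, (p : ℕ) ^ l p := by
  refine finprod_eq_prod_of_mulSupport_subset _ fun p hp => ?_
  by_contra h
  exact hp (by simp [hS p h])

lemma primeProd_pos (l : Nat.Primes → ℕ) : 0 < primeProd l :=
  finprod_induction (fun n : ℕ => 0 < n) one_pos (fun _ _ => Nat.mul_pos)
    fun p => pow_pos p.2.pos _

lemma pow_dvd_primeProd_iff {l : Nat.Primes → ℕ} {S : Finset Nat.Primes} (hS : ∀ p ∉ S, l p = 0)
    (p : Nat.Primes) (k : ℕ) : (p : ℕ) ^ k ∣ primeProd l ↔ k ≤ l p := by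
  have hne : ∀ r ∈ S, (r : ℕ) ^ l r ≠ 0 := fun r _ => pow_ne_zero _ r.2.ne_zero
  rw [p.2.pow_dvd_iff_le_factorization (primeProd_pos l).ne']
  have h : (primeProd l).factorization p = l p := by
    rw [primeProd_eq_prod hS, Nat.factorization_prod hne, Finsupp.finsetSum_apply]
    have h1 : ∀ r ∈ S, ((r : ℕ) ^ l r).factorization p = if r = p then l p else 0 := by
      intro r _
      rw [r.2.factorization_pow]
      by_cases hr : r = p
      · simp [hr]
      · have : (r : ℕ) ≠ p := fun h => hr (Subtype.ext h)
        simp [hr, this]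
    rw [Finset.sum_congr rfl h1, Finset.sum_ite_eq']
    by_cases hp : p ∈ S
    · simp [hp]
    · simp [hp, hS p hp]
  rw [h]

lemma hasSum_log_primeProd {l : Nat.Primes → ℕ} {S : Finset Nat.Primes}
    (hS : ∀ p ∉ S, l p = 0) :
    HasSum (fun p : Nat.Primes => Real.log (p : ℕ) * (l p : ℝ)) (Real.log (primeProd l)) := by
  have h : Real.log (primeProd l) = ∑ p ∈ S, Real.log (p : ℕ) * (l p : ℝ) := by
    rw [primeProd_eq_prod hS]
    push_cast
    rw [Real.log_prod fun p _ => pow_ne_zero _ (by exact_mod_cast p.2.ne_zero)]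
    exact Finset.sum_congr rfl fun p _ => by rw [Real.log_pow, mul_comm]
  rw [h]
  exact hasSum_sum_of_ne_finset_zero fun p hp => by simp [hS p hp]

namespace IntegerAdele

variable {Ω' : Type*} [MeasurableSpace Ω'] {P' : Measure Ω'} {s m : ℕ}
  {V : Fin s → Ω' → IntegerAdele}

lemma ae_minLambda_ne_top (hV : ∀ j, HasLaw (V j) haar P') (hVindep : iIndepFun V P')
    {f : Fin m → MvPolynomial (Fin s) ℤ} {i : Fin m} (hf : f i ≠ 0) :
    ∀ᵐ ω ∂P', ∀ p : Nat.Primes, minLambda f p (fun j => V j ω) ≠ ⊤ := by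
  rw [ae_all_iff]
  intro p
  filter_upwards [ae_aeval_apply_ne_zero hV hVindep p hf] with ω hω htop
  have h1 : ∀ k : ℕ, ((p : ℕ) : ℤ_[(p : ℕ)]) ^ k ∣ (MvPolynomial.aeval (fun j => V j ω) (f i)) p :=
    fun k => (natCast_pow_dvd_iff p k _).1
      ((le_minLambda_iff f p (fun j => V j ω) k).1 (htop ▸ le_top) i)
  refine hω ((FiniteMultiplicity.not_iff_forall.2 h1 : ¬ FiniteMultiplicity _ _) ?_).elim
  exact FiniteMultiplicity.of_prime_left PadicInt.prime_p hω

/-- The limit variable: almost surely the minimal valuations are finite, and vanish for all but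
finitely many primes, so that they are the exponents of a positive integer. -/
lemma exists_measurable_gcd [IsProbabilityMeasure P'] (hV : ∀ j, HasLaw (V j) haar P')
    (hVindep : iIndepFun V P') {f : Fin m → MvPolynomial (Fin s) ℤ}
    (hF : NoCommonFactor (Finset.univ.image f)) :
    ∃ G : Ω' → ℕ, Measurable G ∧ (∀ ω, 1 ≤ G ω) ∧ ∀ᵐ ω ∂P',
      (∀ p : Nat.Primes, minLambda f p (fun j => V j ω) ≠ ⊤) ∧
      HasSum (fun p : Nat.Primes =>
        Real.log (p : ℕ) * ((minLambda f p fun j => V j ω).toNat : ℝ)) (Real.log (G ω)) ∧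
      ∀ (p : Nat.Primes) (k : ℕ),
        (p : ℕ) ^ k ∣ G ω ↔ (k : ℕ∞) ≤ minLambda f p fun j => V j ω := by
  obtain ⟨i, hi⟩ : ∃ i, f i ≠ 0 := by
    obtain ⟨g, hg, hg0⟩ := hF.1
    obtain ⟨i, -, rfl⟩ := Finset.mem_image.1 hg
    exact ⟨i, hg0⟩
  let l : Ω' → Nat.Primes → ℕ := fun ω p => (minLambda f p fun j => V j ω).toNat
  have hgood : ∀ᵐ ω ∂P', (∀ p : Nat.Primes, minLambda f p (fun j => V j ω) ≠ ⊤) ∧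
      ∃ S : Finset Nat.Primes, ∀ p ∉ S, l ω p = 0 := by
    filter_upwards [ae_minLambda_ne_top hV hVindep hi, ae_finite_one_le_minLambda hV hVindep hF]
      with ω h1 h2
    refine ⟨h1, h2.toFinset, fun p hp => ?_⟩
    rw [Set.Finite.mem_toFinset, Set.mem_ofPred_eq, not_le, Order.lt_one_iff] at hp
    simp [l, hp]
  -- The variable is the almost sure limit of the products over finite sets of primes.
  have hG0 : AEMeasurable (fun ω => primeProd (l ω)) P' := by
    have hl : ∀ p, AEMeasurable (fun ω => l ω p) P' := fun p =>
      (measurable_toNat_minLambda f p).comp_aemeasurable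
        (aemeasurable_pi_lambda (fun ω j => V j ω) fun j => (hV j).aemeasurable)
    refine aemeasurable_of_tendsto_metrizable_ae (atTop : Filter (Finset Nat.Primes))
      (f := fun (S : Finset Nat.Primes) ω => ∏ p ∈ S, (p : ℕ) ^ l ω p)
      (fun S => Finset.aemeasurable_fun_prod S fun p _ =>
        (Measurable.of_discrete (f := fun k : ℕ => (p : ℕ) ^ k)).comp_aemeasurable (hl p)) ?_
    filter_upwards [hgood] with ω hω
    obtain ⟨S, hS⟩ := hω.2
    refine tendsto_const_nhds.congr' ?_
    filter_upwards [eventually_ge_atTop S] with T hT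
    exact primeProd_eq_prod fun p hp => hS p fun h => hp (hT h)
  -- The maximum with `1` keeps the measurable modification positive everywhere.
  refine ⟨fun ω => max 1 (hG0.mk _ ω), measurable_const.max hG0.measurable_mk,
    fun ω => le_max_left _ _, ?_⟩
  filter_upwards [hgood, hG0.ae_eq_mk] with ω hω hmk
  obtain ⟨h1, S, hS⟩ := hω
  rw [← hmk, max_eq_right (primeProd_pos _)]
  refine ⟨h1, hasSum_log_primeProd hS, fun p k => ?_⟩
  rw [pow_dvd_primeProd_iff hS, ← Nat.cast_le (α := ℕ∞), ENat.natCast_toNat (h1 p)]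

/-- The greatest common divisor of the limit variable with `q` is a function of the residues
modulo `q`. -/
lemma gcd_eq_gcd_absGCD_residue {f : Fin m → MvPolynomial (Fin s) ℤ} {v : Fin s → IntegerAdele}
    {g : ℕ} (hg : ∀ (p : Nat.Primes) (k : ℕ), (p : ℕ) ^ k ∣ g ↔ (k : ℕ∞) ≤ minLambda f p v)
    {q : ℕ} (hq : q ≠ 0) :
    g.gcd q = (absGCD fun i =>
      MvPolynomial.eval (fun j => (residue q (v j) : ℤ)) (f i)).gcd q := by
  have key : ∀ d, d ∣ q → (d ∣ g ↔ d ∣ absGCD fun i =>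
      MvPolynomial.eval (fun j => (residue q (v j) : ℤ)) (f i)) := by
    intro d hd
    have hd0 : d ≠ 0 := ne_zero_of_dvd_ne_zero hq hd
    simp only [dvd_absGCD_iff, ← natCast_dvd_aeval_iff hd hq, natCast_dvd_iff hd0]
    rw [Nat.dvd_iff_prime_pow_dvd_dvd]
    constructor
    · intro h i p k hk
      exact (natCast_pow_dvd_iff p k _).1
        ((le_minLambda_iff f p v k).1 ((hg p k).1 (h p k p.2 hk)) i)
    · intro h p k hp hk
      exact (hg ⟨p, hp⟩ k).2 ((le_minLambda_iff f ⟨p, hp⟩ v k).2 fun i =>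
        (natCast_pow_dvd_iff ⟨p, hp⟩ k _).2 (h i ⟨p, hp⟩ k hk))
  refine Nat.dvd_antisymm (Nat.dvd_gcd ?_ (Nat.gcd_dvd_right _ _))
    (Nat.dvd_gcd ?_ (Nat.gcd_dvd_right _ _))
  · exact (key _ (Nat.gcd_dvd_right _ _)).1 (Nat.gcd_dvd_left _ _)
  · exact (key _ (Nat.gcd_dvd_right _ _)).2 (Nat.gcd_dvd_left _ _)

lemma absGCD_gcd_eq (f : Fin m → MvPolynomial (Fin s) ℤ) (x : Fin s → ℤ) {q : ℕ} (hq : q ≠ 0) :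
    (absGCD fun i => MvPolynomial.eval x (f i)).gcd q = (absGCD fun i =>
      MvPolynomial.eval (fun j => (residue q (x j : IntegerAdele) : ℤ)) (f i)).gcd q := by
  have key : ∀ d, d ∣ q → (d ∣ (absGCD fun i => MvPolynomial.eval x (f i)) ↔ d ∣ absGCD fun i =>
      MvPolynomial.eval (fun j => (residue q (x j : IntegerAdele) : ℤ)) (f i)) := by
    intro d hd
    simp only [dvd_absGCD_iff, ← natCast_dvd_eval_iff hd hq]
  refine Nat.dvd_antisymm (Nat.dvd_gcd ?_ (Nat.gcd_dvd_right _ _))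
    (Nat.dvd_gcd ?_ (Nat.gcd_dvd_right _ _))
  · exact (key _ (Nat.gcd_dvd_right _ _)).1 (Nat.gcd_dvd_left _ _)
  · exact (key _ (Nat.gcd_dvd_right _ _)).2 (Nat.gcd_dvd_left _ _)

end IntegerAdele

/-! ### A criterion for convergence in law -/

/-- A natural number with no prime factor above `M`, and not divisible by the `k`-th power of a
prime up to `M`, divides `M ! ^ k`. -/
lemma dvd_factorial_pow {x M k : ℕ} (h1 : ∀ p : ℕ, p.Prime → M < p → ¬ p ∣ x)
    (h2 : ∀ p : ℕ, p.Prime → p ≤ M → ¬ p ^ k ∣ x) : x ∣ M.factorial ^ k := by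
  rw [Nat.dvd_iff_prime_pow_dvd_dvd]
  intro p j hp hj
  rcases j.eq_zero_or_pos with rfl | hj0
  · simp
  have hpM : p ≤ M := by
    by_contra! h
    exact h1 p hp h ((dvd_pow_self p hj0.ne').trans hj)
  have hjk : j ≤ k := by
    by_contra! h
    exact h2 p hp hpM ((pow_dvd_pow p h.le).trans hj)
  exact (pow_dvd_pow p hjk).trans (pow_dvd_pow_of_dvd (Nat.dvd_factorial hp.pos hpM) k)

lemma pow_dvd_gcd_factorial_pow_iff {x M k p : ℕ} (hp : p.Prime) (hpM : p ≤ M) :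
    p ^ k ∣ x.gcd (M.factorial ^ k) ↔ p ^ k ∣ x := by
  rw [Nat.dvd_gcd_iff]
  exact and_iff_left (pow_dvd_pow_of_dvd (Nat.dvd_factorial hp.pos hpM) k)

/-- A criterion for convergence in law of random natural numbers to a positive limit: it suffices
that the greatest common divisors with each fixed `q` converge in law, and that large primes
rarely divide the given variables. The first condition also controls the powers of small primes, so
that each variable divides a common `q` with high probability. -/
lemma tendstoInDistribution_of_gcd {ι : Type*} {l : Filter ι} [l.IsCountablyGenerated]
    {Ω : ι → Type*} [∀ n, MeasurableSpace (Ω n)]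
    {P : ∀ n, Measure (Ω n)} [∀ n, IsProbabilityMeasure (P n)] {X : ∀ n, Ω n → ℕ}
    (hX : ∀ n, AEMeasurable (X n) (P n))
    {Ω' : Type*} [MeasurableSpace Ω'] {P' : Measure Ω'} [IsProbabilityMeasure P'] {G : Ω' → ℕ}
    (hG : Measurable G) (hG1 : ∀ ω, 1 ≤ G ω)
    (hgcd : ∀ (q : ℕ), q ≠ 0 → ∀ A : Set ℕ, Tendsto
      (fun n => (P n).real {ω | (X n ω).gcd q ∈ A}) l (𝓝 (P'.real {ω | (G ω).gcd q ∈ A})))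
    (htail : ∀ ε > 0, ∃ M₀ : ℕ, ∀ M ≥ M₀, ∀ᶠ n in l,
      (P n).real {ω | ∃ p : ℕ, p.Prime ∧ M < p ∧ p ∣ X n ω} ≤ ε) :
    TendstoInDistribution X l G P P' := by
  refine ⟨hX, hG.aemeasurable, ?_⟩
  have hmain : ∀ (A : Set ℕ) (ε : ℝ), 0 < ε →
      ∀ᶠ n in l, P'.real {ω | G ω ∈ A} - ε ≤ (P n).real {ω | X n ω ∈ A} := by
    intro A ε hε
    -- `K` bounds `G` with high probability. Then `G` divides `M !` for `M ≥ K`, and is not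
    -- divisible by a `(K + 1)`-st power of a prime.
    have hlim : Tendsto (fun K : ℕ => P'.real {ω | G ω ≤ K}) atTop (𝓝 1) := by
      have h1 := tendsto_measure_iUnion_atTop (μ := P') (s := fun K : ℕ => {ω | G ω ≤ K})
        fun K L hKL ω hω => le_trans (show G ω ≤ K from hω) hKL
      have h2 : (⋃ K : ℕ, {ω | G ω ≤ K}) = Set.univ :=
        Set.eq_univ_of_forall fun ω => Set.mem_iUnion.2 ⟨G ω, le_refl (G ω)⟩
      rw [h2, measure_univ] at h1
      exact (ENNReal.tendsto_toReal ENNReal.one_ne_top).comp h1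
    obtain ⟨K, hK⟩ := (hlim.eventually (lt_mem_nhds (by linarith : 1 - ε / 3 < 1))).exists
    obtain ⟨M₀, hM₀⟩ := htail (ε / 3) (by positivity)
    set M := max K M₀ with hM
    set q := M.factorial ^ (K + 1) with hq
    set B : Set ℕ := {g | g ∈ A ∧ ∀ p : ℕ, p.Prime → p ≤ M → ¬ p ^ (K + 1) ∣ g} with hB
    -- Membership of the greatest common divisor with `q` in `B` forces the variable, unless it has
    -- a prime factor above `M`, to divide `q` and hence to lie in `A`.
    have hGB : {ω | G ω ∈ A} ∩ {ω | G ω ≤ K} ⊆ {ω | (G ω).gcd q ∈ B} := by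
      rintro ω ⟨h1, h2⟩
      have h2' : G ω ≤ K := h2
      have hdvd : G ω ∣ q := (Nat.dvd_factorial (hG1 ω) (h2'.trans (le_max_left _ _))).trans
        (dvd_pow_self _ (Nat.succ_ne_zero K))
      refine ⟨?_, fun p hp hpM hdiv => ?_⟩
      · rw [Nat.gcd_eq_left hdvd]
        exact h1
      · rw [Nat.gcd_eq_left hdvd] at hdiv
        have h3 := Nat.le_of_dvd (hG1 ω) hdiv
        have h4 : 2 ^ (K + 1) ≤ p ^ (K + 1) := Nat.pow_le_pow_left hp.two_le _
        have h5 : K + 1 < 2 ^ (K + 1) := Nat.lt_two_pow_self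
        omega
    have hXB : ∀ n, {ω | (X n ω).gcd q ∈ B} ⊆
        {ω | X n ω ∈ A} ∪ {ω | ∃ p : ℕ, p.Prime ∧ M < p ∧ p ∣ X n ω} := by
      intro n ω hω
      obtain ⟨h1, h2⟩ := hω
      by_cases h3 : ∃ p : ℕ, p.Prime ∧ M < p ∧ p ∣ X n ω
      · exact Or.inr h3
      · push Not at h3
        have hdvd : X n ω ∣ q := dvd_factorial_pow h3 fun p hp hpM hdiv =>
          h2 p hp hpM ((pow_dvd_gcd_factorial_pow_iff hp hpM).2 hdiv)
        rw [Nat.gcd_eq_left hdvd] at h1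
        exact Or.inl h1
    have hG2 : P'.real {ω | G ω ∈ A} - ε / 3 ≤ P'.real {ω | (G ω).gcd q ∈ B} := by
      have hAm : {ω | G ω ∈ A} ⊆ {ω | (G ω).gcd q ∈ B} ∪ {ω | G ω ≤ K}ᶜ := by
        intro ω hω
        by_cases h : G ω ≤ K
        · exact Or.inl (hGB ⟨hω, h⟩)
        · exact Or.inr h
      have h1 := (measureReal_mono (μ := P') hAm).trans (measureReal_union_le _ _)
      have hKm : MeasurableSet {ω | G ω ≤ K} := hG measurableSet_Iic
      rw [probReal_compl_eq_one_sub hKm] at h1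
      linarith
    have hev := (hgcd q (pow_ne_zero _ M.factorial_ne_zero) B).eventually
      (lt_mem_nhds (by linarith : P'.real {ω | (G ω).gcd q ∈ B} - ε / 3 <
        P'.real {ω | (G ω).gcd q ∈ B}))
    filter_upwards [hev, hM₀ M (le_max_right _ _)] with n h1 h2
    have h3 := (measureReal_mono (μ := P n) (hXB n)).trans (measureReal_union_le _ _)
    linarith
  refine tendsto_of_forall_isOpen_le_liminf' fun A _ => ?_
  have hA : MeasurableSet A := MeasurableSet.of_discrete
  simp only [ProbabilityMeasure.coe_mk]
  rw [le_liminf_iff]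
  intro y hy
  rw [Measure.map_apply hG hA] at hy
  have hy_top : y ≠ ⊤ := hy.ne_top
  have hy' : y.toReal < P'.real {ω | G ω ∈ A} :=
    (ENNReal.toReal_lt_toReal hy_top (measure_ne_top _ _)).2 hy
  filter_upwards [hmain A ((P'.real {ω | G ω ∈ A} - y.toReal) / 2) (by linarith)] with n hn
  rw [Measure.map_apply_of_aemeasurable (hX n) hA]
  refine (ENNReal.toReal_lt_toReal hy_top (measure_ne_top _ _)).1 ?_
  change y.toReal < (P n).real {ω | X n ω ∈ A}
  linarith

/-! ### Convergence of the greatest common divisors -/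

lemma measureReal_uniformOn_box {s n : ℕ} {Ω : Type*} [MeasurableSpace Ω] {P : Measure Ω}
    {U : Ω → Fin s → ℤ}
    (hU : HasLaw U (uniformOn {x : Fin s → ℤ | ∀ j, 1 ≤ x j ∧ x j ≤ (n : ℤ)}) P)
    (Q : (Fin s → ℤ) → Prop) :
    P.real {ω | Q (U ω)} = (countIn (box s n) Q : ℝ) / n ^ s := by
  classical
  have hbox : {x : Fin s → ℤ | ∀ j, 1 ≤ x j ∧ x j ≤ (n : ℤ)} = (box s n : Set (Fin s → ℤ)) := by
    ext x
    exact mem_box.symm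
  have h1 : uniformOn (box s n : Set (Fin s → ℤ)) {x | Q x} =
      uniformOn (box s n : Set (Fin s → ℤ)) ((box s n).filter Q : Finset (Fin s → ℤ)) := by
    rw [← uniformOn_inter_self (box s n).finite_toSet]
    congr 1
    ext x
    simp
  rw [measureReal_def, hU.measure_eq (Set.to_countable _).measurableSet, hbox, h1,
    uniformOn_apply_finset, Finset.inter_eq_right.2 (Finset.filter_subset _ _), card_box,
    countIn_eq]
  simp

theorem theorem3p1 {s m : ℕ} (hm : 2 ≤ m)
    (f : Fin m → MvPolynomial (Fin s) ℤ) (hf : ∀ i, f i ≠ 0)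
    -- no common factor of positive degree
    (hcop : ∀ g : MvPolynomial (Fin s) ℤ, (∀ i, g ∣ f i) → g.totalDegree = 0)
    -- `U n` is uniformly distributed on `{1, …, n} ^ s`, for `n = 1, 2, …`
    {Ω : ℕ+ → Type*} [∀ n, MeasurableSpace (Ω n)]
    (P : ∀ n, Measure (Ω n)) [∀ n, IsProbabilityMeasure (P n)]
    (U : ∀ n, Ω n → Fin s → ℤ)
    (hU : ∀ n, HasLaw (U n)
      (uniformOn {x : Fin s → ℤ | ∀ j, 1 ≤ x j ∧ x j ≤ ((n : ℕ) : ℤ)}) (P n))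
    -- `V 1, …, V s` are independent Haar distributed integer adeles
    {Ω' : Type*} [MeasurableSpace Ω'] (P' : Measure Ω') [IsProbabilityMeasure P']
    (V : Fin s → Ω' → IntegerAdele)
    (hV : ∀ j, HasLaw (V j) IntegerAdele.haar P') (hVindep : iIndepFun V P') :
    ∃ G : Ω' → ℕ, Measurable G ∧ (∀ ω, 1 ≤ G ω) ∧
      TendstoInDistribution
        (fun n ω => absGCD fun i => MvPolynomial.eval (U n ω) (f i)) atTop G P P' ∧
      ∀ᵐ ω ∂P',
        (∀ p : Nat.Primes,
          (⨅ i, IntegerAdele.lambda p (MvPolynomial.aeval (fun j => V j ω) (f i))) ≠ ⊤) ∧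
        HasSum
          (fun p : Nat.Primes => Real.log (p : ℕ) *
            ((⨅ i, IntegerAdele.lambda p
              (MvPolynomial.aeval (fun j => V j ω) (f i))).toNat : ℝ))
          (Real.log (G ω)) := by
  have hF : NoCommonFactor (Finset.univ.image f) := by
    refine ⟨⟨f ⟨0, by omega⟩, Finset.mem_image_of_mem _ (Finset.mem_univ _), hf _⟩, fun g hg => ?_⟩
    exact hcop g fun i => hg _ (Finset.mem_image_of_mem _ (Finset.mem_univ i))
  obtain ⟨G, hGm, hG1, hG⟩ := IntegerAdele.exists_measurable_gcd hV hVindep hF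
  have hval : Tendsto (fun n : ℕ+ => (n : ℕ)) atTop atTop :=
    tendsto_atTop_atTop.2 fun b => ⟨b.succPNat, fun n hn =>
      (Nat.le_succ b).trans (PNat.coe_le_coe _ _ |>.2 hn)⟩
  refine ⟨G, hGm, hG1, tendstoInDistribution_of_gcd ?_ hGm hG1 ?_ ?_, ?_⟩
  · intro n
    exact (measurable_of_countable fun x : Fin s → ℤ =>
      absGCD fun i => MvPolynomial.eval x (f i)).comp_aemeasurable (hU n).aemeasurable
  · intro q hq A
    have h1 := (IntegerAdele.tendsto_countIn_residue hV hVindep hq fun a =>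
      (absGCD fun i => MvPolynomial.eval (fun j => (a j : ℤ)) (f i)).gcd q ∈ A).comp hval
    have h2 : P'.real {ω | (G ω).gcd q ∈ A} = P'.real {ω | (absGCD fun i =>
        MvPolynomial.eval (fun j => (IntegerAdele.residue q (V j ω) : ℤ)) (f i)).gcd q ∈ A} := by
      refine measureReal_congr ?_
      filter_upwards [hG] with ω hω
      have h3 := IntegerAdele.gcd_eq_gcd_absGCD_residue hω.2.2 hq
      exact propext (by
        change (G ω).gcd q ∈ A ↔ _
        rw [h3]
        rfl)
    rw [h2]
    refine h1.congr fun n => ?_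
    rw [measureReal_uniformOn_box (hU n) fun x =>
      (absGCD fun i => MvPolynomial.eval x (f i)).gcd q ∈ A]
    have h4 : (fun x : Fin s → ℤ => (absGCD fun i => MvPolynomial.eval x (f i)).gcd q ∈ A) =
        fun x => (absGCD fun i => MvPolynomial.eval (fun j =>
          (IntegerAdele.residue q (x j : IntegerAdele) : ℤ)) (f i)).gcd q ∈ A :=
      funext fun x => by rw [IntegerAdele.absGCD_gcd_eq f x hq]
    rw [h4]
    rfl
  · intro ε hε
    obtain ⟨C, hC0, hC⟩ := hF.exists_card_prime_gt_le
    obtain ⟨M₀, hM₀⟩ := exists_nat_gt (2 * C / ε)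
    have hsmall : ∀ k : ℕ, M₀ + 1 ≤ k → C / k ≤ ε / 2 := by
      intro k hk
      have hk' : (M₀ : ℝ) + 1 ≤ k := by exact_mod_cast hk
      have hk0 : (0 : ℝ) < k := by
        have : (0 : ℝ) ≤ M₀ := Nat.cast_nonneg _
        linarith
      rw [div_lt_iff₀ hε] at hM₀
      rw [div_le_iff₀ hk0]
      nlinarith
    refine ⟨M₀ + 1, fun M hM => ?_⟩
    filter_upwards [hval.eventually_ge_atTop (M₀ + 1)] with n hn
    have hn0 : (0 : ℝ) < (n : ℕ) := by exact_mod_cast n.pos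
    rw [measureReal_uniformOn_box (hU n) fun x => ∃ p : ℕ, p.Prime ∧ M < p ∧
      p ∣ absGCD fun i => MvPolynomial.eval x (f i), div_le_iff₀ (by positivity)]
    have h1 := hC M n (by omega) n.pos
    simp only [Finset.forall_mem_image, Finset.mem_univ, true_implies] at h1
    simp only [dvd_absGCD_iff]
    refine h1.trans ?_
    gcongr
    linarith [hsmall M hM, hsmall n hn]
  · filter_upwards [hG] with ω hω
    exact ⟨hω.1, hω.2.1⟩
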